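/- **Model.** A real number is represented by a sequence of dyadic rationals: for $m\ge 0$ let $\mathbb D_m$ be the set of signed binary strings with $m$ fractional bits, identified with the dyadic numbers they denote. A function $\varphi$ with $\varphi(0^m)\in\mathbb D_m^d$ represents $x\in\mathbb R^d$ if $|\varphi(0^m)_i-x_i|\le 2^{-m}$ for all $m$ and $i$. An oracle Turing machine $F$ computes $f:T\to\mathbb R^\ell$, $T\subseteq\mathbb R^d$, in polynomial time if there is a polynomial $p$ such that for every $x\in T$, every representation of $x$ as oracle and every $n$, on input $0^n$ it outputs within $p(n)$ steps an element of $\mathbb D_n^\ell$ that is within $2^{-n}$ of $f(x)$ in each coordinate. Oracle access to $f$ means black-box access to such a machine $F$: a query consists of a point $q$ with dyadic coordinates and a string $0^m$, and is answered by the output of $F$ on input $0^m$ with the standard representation of $q$ (truncation or padding with zeros to $m$ fractional bits) as oracle. A point $x$ is given through an oracle for a representation of it. A search problem with such an input $f$, whose solutions are points of $\mathbb R^k$, has *arbitrarily high complexity* if for every $K:\mathbb N\to\mathbb N$ and every oracle Turing machine $M$ there is an admissible input $F$ for which it is not the case that, for every $n\ge 1$, $M$ on input $0^n$ with oracle access to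 $F$ outputs in fewer than $K(n)$ steps a dyadic point that is within $2^{-n}$ (in each coordinate) of a solution. A decision problem has *arbitrarily high complexity* if for every integer $K$ and every oracle Turing machine $M$ there is an admissible input for which $M$ does not give the correct answer in fewer than $K$ steps. For $T\subset\mathbb R^2$ and $f:T\to\mathbb R^2$, a *closed orbit* of $\dot x=f(x)$ in $T$ is the image of a nonconstant periodic solution in $T$. A *limit cycle* is a closed orbit that is the $\omega$-limit set of a forward solution, or the $\alpha$-limit set of a backward solution, in $T$ starting outside of it. **Theorem (Poincaré–Bendixson Impossibility).** Let $T=\{x\in\mathbb R^2: 1\le\|x\|\le 2\}$. There is a constant $L$ such that the following problems have arbitrarily high complexity. In each of them the admissible inputs are the polynomial-time oracle machines computing a function $f:T\to T$ that is $L$-Lipschitz and continuously differentiable on $T$ and has no fixpoint (that is, $f(x)\neq 0$ on $T$), such that every point of $T$ is the start of a solution of $\dot x=f(x)$ which remains in $T$ for all $t\ge 0$, and such that there is exactly one closed orbit in $T$, and it is a limit cycle. 1. Given oracle access to $f$, find a point on a limit cycle of $\dot x=f(x)$. 2. Given oracle access to $f$ and to a point $x\in T$, determine whether $x$ is on a limit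 cycle of $\dot x=f(x)$. 3. For every fixed $\varepsilon$ with $0<\varepsilon\le 1/4$ (in particular $\varepsilon=1/4$): given oracle access to $f$ and to a point $x\in T$, determine whether $x$ is at distance at most $\varepsilon$ from a limit cycle of $\dot x=f(x)$. In particular, these problems have arbitrarily high complexity when $f$ ranges over all polynomial-time computable, Lipschitz continuous, continuously differentiable, fixpoint-free functions from a two-dimensional compact domain to itself. -/

import Mathlib

open Set Filter Topology

/-! ### Dyadic numbers as strings -/

/-- The symbols used for input, output and communication with the oracle. -/
inductive Symb
  | zero | one | plus | minus | point | sep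
  deriving DecidableEq

/-- A dyadic rational in binary notation: a sign, the integer bits `a_k … a_0` and the fractional
bits `a_{-1} … a_{-m}`, most significant bit first, with `a_k = 1` unless `k = 0`. -/
structure DyadicString where
  /-- the sign (`true` for minus) -/
  neg : Bool
  /-- the integer part -/
  int : List Bool
  /-- the fractional part -/
  frac : List Bool
  int_ne_nil : int ≠ []
  leading : int.length ≠ 1 → int.head? = some true

namespace DyadicString

/-- The natural number with the given binary digits, most significant digit first. -/
def natOfBits (l : List Bool) : ℕ := l.foldl (fun a b => 2 * a + b.toNat) 0

/-- The number denoted by a dyadic string. -/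
noncomputable def value (a : DyadicString) : ℝ :=
  (if a.neg then -1 else 1) * (natOfBits (a.int ++ a.frac) : ℝ) / 2 ^ a.frac.length

/-- The number `m` of fractional bits; the strings of precision `m` form the set `𝔻_m`. -/
def prec (a : DyadicString) : ℕ := a.frac.length

/-- The symbol of a bit. -/
def bitSymb (b : Bool) : Symb := if b then Symb.one else Symb.zero

/-- A dyadic string written out over the alphabet. -/
def encode (a : DyadicString) : List Symb :=
  (if a.neg then Symb.minus else Symb.plus) ::
    (a.int.map bitSymb ++ Symb.point :: a.frac.map bitSymb)

/-- Truncation of a dyadic number (towards zero), or padding with zeros, to precision `m`. -/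
def toPrec (a : DyadicString) (m : ℕ) : DyadicString :=
  { a with frac := (a.frac ++ List.replicate m false).take m }

end DyadicString

/-- A tuple of dyadic strings written out, each followed by a separator. -/
def encodeTuple {d : ℕ} (q : Fin d → DyadicString) : List Symb :=
  (List.ofFn fun i => (q i).encode ++ [Symb.sep]).flatten

/-- The string `0^m`. -/
def unary (m : ℕ) : List Symb := List.replicate m Symb.zero

/-- `q` approximates the point `x` to within `2^{-m}` in every coordinate. -/
def Approximates {d : ℕ} (q : Fin d → DyadicString) (m : ℕ) (x : EuclideanSpace ℝ (Fin d)) :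
    Prop :=
  ∀ i, |(q i).value - x i| ≤ (1 / 2 : ℝ) ^ m

/-- `φ` represents the point `x`: for every `m`, `φ m` is a tuple of dyadic numbers from `𝔻_m`
which approximates `x` to within `2^{-m}`. -/
def Represents {d : ℕ} (φ : ℕ → Fin d → DyadicString) (x : EuclideanSpace ℝ (Fin d)) : Prop :=
  ∀ m, (∀ i, (φ m i).prec = m) ∧ Approximates (φ m) m x

/-! ### Oracle Turing machines -/

/-- The four distinguished stacks of an oracle machine. -/
inductive Port
  | input | query | answer | output
  deriving DecidableEq

/-- An oracle Turing machine: a multi-stack Turing machine program in the sense of `Turing.TM2`,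
with finitely many stacks, states and symbols, four of the stacks being used for input, oracle
queries, oracle answers and output. A label `l` with `ask l = some l'` is a query state: there the
machine calls the oracle and continues at `l'`. At the other labels it executes `prog l`. -/
structure OracleTM where
  /-- indices of the work stacks -/
  K : Type
  [decK : DecidableEq K]
  [finK : Fintype K]
  /-- alphabets of the work stacks -/
  Γ : K → Type
  [finΓ : ∀ k, Fintype (Γ k)]
  /-- labels (states of the finite control) -/
  Λ : Type
  [finΛ : Fintype Λ]
  /-- starting label -/
  main : Λ
  /-- values of the internal register -/
  σ : Type
  [finσ : Fintype σ]
  /-- initial value of the register -/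
  init : σ
  /-- query states, with their successors -/
  ask : Λ → Option Λ
  /-- the program -/
  prog : Λ → Turing.TM2.Stmt (Sum.elim (fun _ : Port => Symb) Γ) Λ σ

namespace OracleTM

instance (M : OracleTM) : DecidableEq M.K := M.decK

/-- Configurations of an oracle machine. -/
abbrev Cfg (M : OracleTM) : Type :=
  Turing.TM2.Cfg (Sum.elim (fun _ : Port => Symb) M.Γ) M.Λ M.σ

/-- One step of `M` with the oracle `O`. A halted machine stays as it is. An oracle call takes one
step: it replaces the contents of the answer stack by the answer of the oracle to the string on the
query stack, and empties the query stack. Any other step is a step of the underlying machine. -/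
def next (M : OracleTM) (O : List Symb → List Symb) : M.Cfg → M.Cfg
  | ⟨none, v, S⟩ => ⟨none, v, S⟩
  | ⟨some l, v, S⟩ =>
    match M.ask l with
    | some l' =>
      ⟨some l', v, Function.update
        (Function.update S (Sum.inl Port.answer) (O (S (Sum.inl Port.query))))
        (Sum.inl Port.query) []⟩
    | none => Turing.TM2.stepAux (M.prog l) v S

/-- The initial configuration on input `w`: all stacks are empty except the input stack. -/
def start (M : OracleTM) (w : List Symb) : M.Cfg :=
  ⟨some M.main, M.init, Function.update (fun _ => []) (Sum.inl Port.input) w⟩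

/-- On input `w` and with oracle `O`, the machine `M` halts after at most `t` steps with output
`out`. -/
def OutputsWithin (M : OracleTM) (O : List Symb → List Symb) (w : List Symb) (t : ℕ)
    (out : List Symb) : Prop :=
  ((M.next O)^[t] (M.start w)).l = none ∧
    ((M.next O)^[t] (M.start w)).stk (Sum.inl Port.output) = out

end OracleTM

/-! ### Computable real functions -/

/-- The oracle given by a representation `φ` of a point: it answers `0^m` by `φ m`. -/
def nameOracle {d : ℕ} (φ : ℕ → Fin d → DyadicString) : List Symb → List Symb :=
  fun w => if w = unary w.length then encodeTuple (φ w.length) else []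

/-- The oracle machine `F` computes `f : T → ℝˡ`, `T ⊆ ℝᵈ`, in polynomial time: there is a
polynomial `p` such that for every `x ∈ T`, every representation of `x` as an oracle, and every
`n`, on input `0^n` it outputs within `p(n)` steps an element of `𝔻_n` (in each coordinate) which is
within `2^{-n}` of `f x`. -/
def ComputesInPolyTime {d l : ℕ} (F : OracleTM) (T : Set (EuclideanSpace ℝ (Fin d)))
    (f : EuclideanSpace ℝ (Fin d) → EuclideanSpace ℝ (Fin l)) : Prop :=
  ∃ p : Polynomial ℕ, ∀ x ∈ T, ∀ φ : ℕ → Fin d → DyadicString, Represents φ x → ∀ n : ℕ,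
    ∃ q : Fin l → DyadicString, (∀ i, (q i).prec = n) ∧ Approximates q n (f x) ∧
      F.OutputsWithin (nameOracle φ) (unary n) (p.eval n) (encodeTuple q)

open Classical in
/-- Black box access to the function computed by the oracle machine `F`. A query consists of a point
`q` with dyadic coordinates, followed by `0^m`; it is answered by the output of `F` on input `0^m`
for the point `q`, i.e. by an approximation of `f q` to within `2^{-m}`. (All other strings, and
queries on which `F` does not halt, are answered by the empty string.) -/
noncomputable def blackBox (d : ℕ) (F : OracleTM) : List Symb → List Symb := fun w =>
  if h : ∃ (out : List Symb) (q : Fin d → DyadicString) (m t : ℕ), w = encodeTuple q ++ unary m ∧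
      F.OutputsWithin (nameOracle fun j i => (q i).toPrec j) (unary m) t out
  then h.choose else []

/-- Access to the function computed by `F` and to the representation `φ` of a point: `0^m` is
answered by `φ m`, the other queries by the black box for `F`. -/
noncomputable def blackBoxWithPoint {d : ℕ} (F : OracleTM) (φ : ℕ → Fin d → DyadicString) :
    List Symb → List Symb := fun w =>
  if w = unary w.length then nameOracle φ w else blackBox d F w

/-! ### Arbitrarily high complexity -/

/-- The search problem "given oracle access to a polynomial time computable `f : T → ℝˡ` satisfying
`P f`, find a point of `Sol f`" has arbitrarily high complexity: for every `K : ℕ → ℕ` and every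
machine `M` there is an input oracle machine `F`, computing such a function `f`, for which it is not
the case that `M` computes the output with precision `2^{-n}` in fewer than `K n` steps
(for all `n ≥ 1`). -/
def SearchArbitrarilyHighComplexity {d l k : ℕ} (T : Set (EuclideanSpace ℝ (Fin d)))
    (P : (EuclideanSpace ℝ (Fin d) → EuclideanSpace ℝ (Fin l)) → Prop)
    (Sol : (EuclideanSpace ℝ (Fin d) → EuclideanSpace ℝ (Fin l)) →
      Set (EuclideanSpace ℝ (Fin k))) : Prop :=
  ∀ (K : ℕ → ℕ) (M : OracleTM), ∃ (F : OracleTM)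
    (f : EuclideanSpace ℝ (Fin d) → EuclideanSpace ℝ (Fin l)),
    ComputesInPolyTime F T f ∧ P f ∧
    ∃ n : ℕ, 1 ≤ n ∧ ¬ ∃ t < K n, ∃ q : Fin k → DyadicString,
      M.OutputsWithin (blackBox d F) (unary n) t (encodeTuple q) ∧ ∃ y ∈ Sol f, Approximates q n y

open Classical in
/-- The decision problem "given oracle access to a polynomial time computable `f : T → ℝˡ`
satisfying `P f` and to a point `x ∈ T`, decide whether `x ∈ Yes f`" has arbitrarily high
complexity: for every integer `K` and every machine `M` there is an input (an oracle machine `F`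
computing such a function `f`, and a point `x ∈ T` with a representation `φ`) for which `M` does not
give the correct answer in fewer than `K` steps. The answers are `1` for yes and `0` for no. -/
def DecisionArbitrarilyHighComplexity {d l : ℕ} (T : Set (EuclideanSpace ℝ (Fin d)))
    (P : (EuclideanSpace ℝ (Fin d) → EuclideanSpace ℝ (Fin l)) → Prop)
    (Yes : (EuclideanSpace ℝ (Fin d) → EuclideanSpace ℝ (Fin l)) →
      Set (EuclideanSpace ℝ (Fin d))) : Prop :=
  ∀ (K : ℕ) (M : OracleTM), ∃ (F : OracleTM)
    (f : EuclideanSpace ℝ (Fin d) → EuclideanSpace ℝ (Fin l)),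
    ComputesInPolyTime F T f ∧ P f ∧ ∃ x ∈ T, ∃ φ : ℕ → Fin d → DyadicString, Represents φ x ∧
      ¬ ∃ t < K, M.OutputsWithin (blackBoxWithPoint F φ) [] t
        [if x ∈ Yes f then Symb.one else Symb.zero]

/-! ### Planar dynamical systems and limit cycles -/

/-- The Euclidean plane. -/
abbrev Plane : Type := EuclideanSpace ℝ (Fin 2)

/-- The annulus with inner radius `1` and outer radius `2`. -/
def annulus : Set Plane := {x | 1 ≤ ‖x‖ ∧ ‖x‖ ≤ 2}

/-- `γ`, on the time interval `I`, is a trajectory of `ẋ = f(x)` which stays in `T`. -/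
def IsTrajectory (f : Plane → Plane) (T : Set Plane) (I : Set ℝ) (γ : ℝ → Plane) : Prop :=
  ∀ t ∈ I, γ t ∈ T ∧ HasDerivWithinAt γ (f (γ t)) I t

/-- `C` is a closed orbit of `ẋ = f(x)` in `T`: the image of a nonconstant periodic trajectory. -/
def IsClosedOrbit (f : Plane → Plane) (T C : Set Plane) : Prop :=
  ∃ γ : ℝ → Plane, IsTrajectory f T univ γ ∧ (∃ p : ℝ, 0 < p ∧ Function.Periodic γ p) ∧
    (∃ t, γ t ≠ γ 0) ∧ C = range γ

/-- `C` is a limit cycle of `ẋ = f(x)` in `T`: a closed orbit which is the `ω`-limit set of a forward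
trajectory, or the `α`-limit set of a backward trajectory, that starts outside of `C`. -/
def IsLimitCycle (f : Plane → Plane) (T C : Set Plane) : Prop :=
  IsClosedOrbit f T C ∧ ∃ γ : ℝ → Plane, γ 0 ∉ C ∧
    ((IsTrajectory f T (Ici 0) γ ∧ {y | MapClusterPt y atTop γ} = C) ∨
      (IsTrajectory f T (Iic 0) γ ∧ {y | MapClusterPt y atBot γ} = C))

/-- The points on limit cycles. -/
def onLimitCycle (f : Plane → Plane) (T : Set Plane) : Set Plane :=
  {x | ∃ C, IsLimitCycle f T C ∧ x ∈ C}

/-- The points at distance at most `ε` from a limit cycle. -/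
def nearLimitCycle (ε : ℝ) (f : Plane → Plane) (T : Set Plane) : Set Plane :=
  {x | ∃ y ∈ onLimitCycle f T, dist x y ≤ ε}

/-- What is known about the inputs: `f` maps `T` to itself, is `L`-Lipschitz and continuously
differentiable on `T` and has no fixpoint (equilibrium) there; every point of `T` is the starting
point of a trajectory that remains in `T` forever; and the system has exactly one closed orbit in
`T`, which is a limit cycle. -/
structure IsInstance (L : NNReal) (T : Set Plane) (f : Plane → Plane) : Prop where
  mapsTo : MapsTo f T T
  lipschitz : LipschitzOnWith L f T
  contDiff : ContDiffOn ℝ 1 f T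
  no_fixpoint : ∀ x ∈ T, f x ≠ 0
  invariant : ∀ x ∈ T, ∃ γ : ℝ → Plane, γ 0 = x ∧ IsTrajectory f T (Ici 0) γ
  exists_limitCycle : ∃ C, IsLimitCycle f T C
  closedOrbit_unique : ∀ C C', IsClosedOrbit f T C → IsClosedOrbit f T C' → C = C'

/-!
In complex notation, the hard inputs are the vector fields `f z = i z + δ (c - |z|²) (1 + i) z` with
`c = 1` or `c = 4` and a tiny `δ > 0`. Their solutions are explicit: the inverse of the squared
radius solves a linear differential equation, and the angle is the time plus the logarithm of the
radius, up to a constant (`isTrajectory_spiral`). All of them spiral towards the circle `|z|² = c`,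
which is the only closed orbit, because `(|z|² - c)²` is nonincreasing along solutions, hence
constant, hence zero, along a periodic one (`eq_circleSq_of_isClosedOrbit`). So each field is an
instance of the problem with Lipschitz constant `3` (`isInstance_spiralField`), and its limit cycle
is the inner boundary circle of the annulus for `c = 1`, and the outer one for `c = 4`.

For `δ = 2 ^ (-(N + 6))` the nonlinear part of the field is so small that for all precisions `n ≤ N`
it can be neglected. Hence the field is computed by a machine which, for `n ≤ N`, answers with a
rounded value of the rotation `i z`, and this answer does not depend on `c` or `N`
(`evalOut_of_le`); only for `n > N` it evaluates the whole polynomial. A query for precision `n` has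
length at least `n`. So the black boxes for these machines agree with a fixed limiting oracle on all
queries of length at most `N`. In a bounded number of steps an algorithm with the limiting oracle
makes only finitely many queries; if `N` exceeds their lengths, the algorithm runs in the same way
for `c = 1` and `c = 4` (`exists_forall_output_eq`). But no point is close to both limit cycles, and
the point `(1, 0)` is on one of them and at distance `1` from the other one, so that some answer is
wrong.

Most of the work goes into the machines which compute the fields in polynomial time. They are
written in a small structured programming language for stacks of symbols, whose programs are
compiled to oracle machines together with a bound for the running time (`Exec.outputsWithin`).
Integers are stored in signed binary notation with digits `-1`, `0`, `1`, so that no case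
distinctions for signs are needed in sums and products; the usual binary digits are computed only
for the output.
-/

/-! ### A structured programming language for oracle machines -/

instance : Fintype Symb :=
  ⟨{Symb.zero, Symb.one, Symb.plus, Symb.minus, Symb.point, Symb.sep}, fun s => by
    cases s <;> simp⟩

/-- Programs working on stacks of symbols, which are indexed by the four ports and by `W`. -/
inductive StackProg (W : Type)
  /-- do nothing -/
  | skip : StackProg W
  /-- push a symbol onto a stack -/
  | push (k : Port ⊕ W) (s : Symb) : StackProg W
  /-- call the oracle -/
  | ask : StackProg W
  /-- sequential composition -/
  | seq (c d : StackProg W) : StackProg W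
  /-- pop a stack and continue according to the symbol found (`none` for an empty stack) -/
  | pop (k : Port ⊕ W) (br : Option Symb → StackProg W) : StackProg W
  /-- as long as a stack is nonempty, pop it and execute the body for the symbol found -/
  | loop (k : Port ⊕ W) (body : Symb → StackProg W) : StackProg W

namespace StackProg

variable {W : Type}

/-- Sequential composition of programs. -/
infixr:60 " ;; " => StackProg.seq

/-- The contents of the stacks, top symbol first. -/
abbrev Store (W : Type) : Type := Port ⊕ W → List Symb

/-- `Exec O c S t S'`: with the oracle `O`, the program `c` takes the store `S` to `S'` in at most
`t` machine steps. -/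
inductive Exec [DecidableEq W] (O : List Symb → List Symb) :
    StackProg W → Store W → ℕ → Store W → Prop
  | skip (S) : Exec O skip S 1 S
  | push (k s S) : Exec O (push k s) S 1 (Function.update S k (s :: S k))
  | ask (S) : Exec O ask S 1 (Function.update
      (Function.update S (Sum.inl Port.answer) (O (S (Sum.inl Port.query))))
        (Sum.inl Port.query) [])
  | seq {c d S S₁ S₂ t₁ t₂} : Exec O c S t₁ S₁ → Exec O d S₁ t₂ S₂ →
      Exec O (seq c d) S (t₁ + t₂) S₂
  | pop {k br S S' t} : Exec O (br (S k).head?) (Function.update S k (S k).tail) t S' →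
      Exec O (pop k br) S (1 + t) S'
  | loop_nil {k body S} : S k = [] → Exec O (loop k body) S 1 S
  | loop_cons {k body S S₁ S₂ s l t₁ t₂} : S k = s :: l →
      Exec O (body s) (Function.update S k l) t₁ S₁ → Exec O (loop k body) S₁ t₂ S₂ →
      Exec O (loop k body) S (1 + t₁ + t₂) S₂
  | weaken {c S S' t t'} : Exec O c S t S' → t ≤ t' → Exec O c S t' S'

/-- The control locations of a program. -/
def Loc : StackProg W → Type
  | skip | push _ _ | ask => Unit
  | seq c d => Loc c ⊕ Loc d
  | pop _ br => Option (Σ o, Loc (br o))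
  | loop _ body => Option (Σ s, Loc (body s))

noncomputable instance instFintypeLoc : (c : StackProg W) → Fintype (Loc c)
  | skip | push _ _ | ask => inferInstanceAs (Fintype Unit)
  | seq c d =>
    have := instFintypeLoc c
    have := instFintypeLoc d
    inferInstanceAs (Fintype (Loc c ⊕ Loc d))
  | pop _ br =>
    have := fun o => instFintypeLoc (br o)
    inferInstanceAs (Fintype (Option (Σ o, Loc (br o))))
  | loop _ body =>
    have := fun s => instFintypeLoc (body s)
    inferInstanceAs (Fintype (Option (Σ s, Loc (body s))))

/-- The location at which a program starts. -/
def entry : (c : StackProg W) → Loc c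
  | skip | push _ _ | ask => ()
  | seq c _ => Sum.inl (entry c)
  | pop _ _ => none
  | loop _ _ => none

/-- The alphabets of the stacks of the compiled machine. -/
abbrev Alph (W : Type) : Port ⊕ W → Type := Sum.elim (fun _ : Port => Symb) fun _ : W => Symb

/-- All the alphabets are the alphabet `Symb`. -/
def toAlph : (k : Port ⊕ W) → Symb → Alph W k
  | Sum.inl _, s => s
  | Sum.inr _, s => s

/-- Inverse of `toAlph`. -/
def ofAlph : (k : Port ⊕ W) → Alph W k → Symb
  | Sum.inl _, s => s
  | Sum.inr _, s => s

/-- Machine statements, with a register for the last symbol popped. -/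
abbrev Stm (W Λ : Type) : Type := Turing.TM2.Stmt (Alph W) Λ (Option Symb)

/-- The instruction at each location, if locations are embedded into the labels of a machine by `e`
and the program exits to the label `x`: either an oracle call with its successor, or a statement. -/
def instr {Λ : Type} : (c : StackProg W) → (Loc c → Λ) → Λ → Loc c → Λ ⊕ Stm W Λ
  | skip, _, x, _ => Sum.inr (.goto fun _ => x)
  | push k s, _, x, _ => Sum.inr (.push k (fun _ => toAlph k s) (.goto fun _ => x))
  | ask, _, x, _ => Sum.inl x
  | seq c d, e, _, Sum.inl l => instr c (fun l => e (Sum.inl l)) (e (Sum.inr (entry d))) l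
  | seq _ d, e, x, Sum.inr l => instr d (fun l => e (Sum.inr l)) x l
  | pop k br, e, _, none => Sum.inr (.pop k (fun _ o => o.map (ofAlph k))
      (.goto fun o => e (some ⟨o, entry (br o)⟩)))
  | pop _ br, e, x, some ⟨o, l⟩ => instr (br o) (fun l => e (some ⟨o, l⟩)) x l
  | loop k body, e, x, none => Sum.inr (.pop k (fun _ o => o.map (ofAlph k))
      (.goto fun o => match o with
        | none => x
        | some s => e (some ⟨s, entry (body s)⟩)))
  | loop _ body, e, _, some ⟨s, l⟩ => instr (body s) (fun l => e (some ⟨s, l⟩)) (e none) l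

/-- The machine with work stacks `W`, a register for the last symbol popped, and the given control
table. -/
abbrev ofTable [DecidableEq W] [Fintype W] {Λ : Type} [Fintype Λ] (main : Λ) (ask : Λ → Option Λ)
    (prog : Λ → Stm W Λ) : OracleTM where
  K := W
  Γ := fun _ => Symb
  finΓ := fun _ => inferInstance
  Λ := Λ
  main := main
  σ := Option Symb
  init := none
  ask := ask
  prog := prog

/-- The machine which executes a program and halts. -/
noncomputable def machine [DecidableEq W] [Fintype W] (c : StackProg W) : OracleTM :=
  ofTable (Λ := Option (Loc c)) (some c.entry)
    (fun
      | none => none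
      | some l => (instr c some none l).getLeft?)
    (fun
      | none => .halt
      | some l => Sum.elim (fun _ => .halt) id (instr c some none l))

/-- A store as the contents of the stacks of the compiled machine. -/
def toStk (S : Store W) : ∀ k, List (Alph W k)
  | Sum.inl p => S (Sum.inl p)
  | Sum.inr w => S (Sum.inr w)

theorem update_toStk_cons [DecidableEq W] (S : Store W) (k : Port ⊕ W) (s : Symb) :
    Function.update (toStk S) k (toAlph k s :: toStk S k) =
      toStk (Function.update S k (s :: S k)) := by
  funext j
  by_cases h : j = k
  · subst h
    rw [Function.update_self]
    rcases j with j | j <;> simp [toStk, toAlph]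
  · rcases j with j | j <;> simp [toStk, Function.update_of_ne h]

theorem update_toStk_tail [DecidableEq W] (S : Store W) (k : Port ⊕ W) :
    Function.update (toStk S) k (toStk S k).tail =
      toStk (Function.update S k (S k).tail) := by
  funext j
  by_cases h : j = k
  · subst h
    rw [Function.update_self]
    rcases j with j | j <;> simp [toStk]
  · rcases j with j | j <;> simp [toStk, Function.update_of_ne h]

theorem head?_toStk (S : Store W) (k : Port ⊕ W) :
    (toStk S k).head?.map (ofAlph k) = (S k).head? := by
  rcases k with k | k
  · show ((S (Sum.inl k)).head?.map fun s => s) = _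
    simp
  · show ((S (Sum.inr k)).head?.map fun s => s) = _
    simp

theorem next_toStk_of_ask [DecidableEq W] [Fintype W] {Λ : Type} [Fintype Λ] {main : Λ}
    {ask : Λ → Option Λ} {prog : Λ → Stm W Λ} (O : List Symb → List Symb) {l x : Λ}
    (h : ask l = some x) (v : Option Symb) (S : Store W) :
    (ofTable main ask prog).next O ⟨some l, v, toStk S⟩ =
      ⟨some x, v, toStk (Function.update
        (Function.update S (Sum.inl Port.answer) (O (S (Sum.inl Port.query))))
          (Sum.inl Port.query) [])⟩ := by
  unfold OracleTM.next
  dsimp only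
  rw [h]
  refine congrArg (Turing.TM2.Cfg.mk _ _) ?_
  funext j
  rcases j with (_ | _ | _ | _) | j <;> rfl

theorem next_toStk_of_prog [DecidableEq W] [Fintype W] {Λ : Type} [Fintype Λ] {main : Λ}
    {ask : Λ → Option Λ} {prog : Λ → Stm W Λ} (O : List Symb → List Symb) {l : Λ} {p : Stm W Λ}
    (h : ask l = none ∧ prog l = p) (v : Option Symb) (S : Store W) :
    (ofTable main ask prog).next O ⟨some l, v, toStk S⟩ = Turing.TM2.stepAux p v (toStk S) := by
  unfold OracleTM.next
  dsimp only
  rw [h.1, h.2]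

/-- A program which is embedded in a machine by `e`, with exit `x`, is executed by this machine. -/
theorem Exec.reach [DecidableEq W] {Λ : Type} [Fintype Λ] [Fintype W] {O : List Symb → List Symb}
    {c : StackProg W} {S S' : Store W} {t : ℕ} (h : Exec O c S t S')
    (main : Λ) (ask : Λ → Option Λ) (prog : Λ → Stm W Λ) (e : Loc c → Λ) (x : Λ)
    (hask : ∀ l y, instr c e x l = Sum.inl y → ask (e l) = some y)
    (hprog : ∀ l p, instr c e x l = Sum.inr p → ask (e l) = none ∧ prog (e l) = p)
    (v : Option Symb) :
    ∃ t' ≤ t, ∃ v', ((ofTable main ask prog).next O)^[t']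
        ⟨some (e c.entry), v, toStk S⟩ = ⟨some x, v', toStk S'⟩ := by
  induction h generalizing x v with
  | skip S =>
    exact ⟨1, le_rfl, v, next_toStk_of_prog O (hprog () _ rfl) v S⟩
  | push k s S =>
    refine ⟨1, le_rfl, v, (next_toStk_of_prog O (hprog () _ rfl) v S).trans ?_⟩
    rw [Turing.TM2.stepAux, update_toStk_cons, Turing.TM2.stepAux]
  | ask S =>
    exact ⟨1, le_rfl, v, next_toStk_of_ask O (hask () _ rfl) v S⟩
  | @seq c d S S₁ S₂ t₁ t₂ _ _ ih₁ ih₂ =>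
    obtain ⟨n₁, hn₁, v₁, e₁⟩ := ih₁ (fun l => e (Sum.inl l)) (e (Sum.inr (entry d)))
      (fun l y hl => hask (Sum.inl l) y hl) (fun l p hl => hprog (Sum.inl l) p hl) v
    obtain ⟨n₂, hn₂, v₂, e₂⟩ := ih₂ (fun l => e (Sum.inr l)) x
      (fun l y hl => hask (Sum.inr l) y hl) (fun l p hl => hprog (Sum.inr l) p hl) v₁
    refine ⟨n₂ + n₁, by omega, v₂, ?_⟩
    rw [Function.iterate_add_apply]
    exact (congrArg _ e₁).trans e₂
  | @pop k br S S' t _ ih =>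
    obtain ⟨n, hn, v', e'⟩ := ih (fun l => e (some ⟨_, l⟩)) x
      (fun l y hl => hask (some ⟨_, l⟩) y hl) (fun l p hl => hprog (some ⟨_, l⟩) p hl) (S k).head?
    refine ⟨n + 1, by omega, v', ?_⟩
    rw [Function.iterate_add_apply, Function.iterate_one]
    refine (congrArg _ ?_).trans e'
    refine (next_toStk_of_prog O (hprog none _ rfl) v S).trans ?_
    rw [Turing.TM2.stepAux, update_toStk_tail, head?_toStk, Turing.TM2.stepAux]
  | @loop_nil k body S hS =>
    refine ⟨1, le_rfl, none, (next_toStk_of_prog O (hprog none _ rfl) v S).trans ?_⟩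
    rw [Turing.TM2.stepAux, update_toStk_tail, head?_toStk, Turing.TM2.stepAux, hS]
    rw [List.tail_nil, ← hS, Function.update_eq_self, hS]
    rfl
  | @loop_cons k body S S₁ S₂ s l t₁ t₂ hS _ _ ih₁ ih₂ =>
    obtain ⟨n₁, hn₁, v₁, e₁⟩ := ih₁ (fun l => e (some ⟨s, l⟩)) (e none)
      (fun l y hl => hask (some ⟨_, l⟩) y hl) (fun l p hl => hprog (some ⟨_, l⟩) p hl) (some s)
    obtain ⟨n₂, hn₂, v₂, e₂⟩ := ih₂ e x hask hprog v₁
    refine ⟨n₂ + (n₁ + 1), by omega, v₂, ?_⟩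
    rw [Function.iterate_add_apply, Function.iterate_add_apply, Function.iterate_one]
    refine (congrArg _ ?_).trans e₂
    refine (congrArg _ ?_).trans e₁
    refine (next_toStk_of_prog O (hprog none _ rfl) v S).trans ?_
    rw [Turing.TM2.stepAux, update_toStk_tail, head?_toStk, Turing.TM2.stepAux, hS]
    rfl
  | weaken _ hle ih =>
    obtain ⟨n, hn, h⟩ := ih e x hask hprog v
    exact ⟨n, hn.trans hle, h⟩

/-- A halted machine stays as it is. -/
theorem _root_.OracleTM.iterate_next_of_halted (M : OracleTM) (O : List Symb → List Symb)
    (C : M.Cfg) (hC : C.l = none) (n : ℕ) : (M.next O)^[n] C = C := by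
  induction n with
  | zero => rfl
  | succ n ih =>
    rw [Function.iterate_succ_apply', ih]
    obtain ⟨l, v, S⟩ := C
    subst hC
    rfl

theorem _root_.OracleTM.OutputsWithin.mono {M : OracleTM} {O : List Symb → List Symb}
    {w out : List Symb} {t t' : ℕ} (h : M.OutputsWithin O w t out) (ht : t ≤ t') :
    M.OutputsWithin O w t' out := by
  obtain ⟨d, rfl⟩ := Nat.exists_eq_add_of_le' ht
  unfold OracleTM.OutputsWithin
  rw [Function.iterate_add_apply, OracleTM.iterate_next_of_halted _ _ _ h.1]
  exact h

theorem _root_.OracleTM.OutputsWithin.unique {M : OracleTM} {O : List Symb → List Symb}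
    {w out out' : List Symb} {t t' : ℕ} (h : M.OutputsWithin O w t out)
    (h' : M.OutputsWithin O w t' out') : out = out' :=
  (h.mono (le_max_left t t')).2.symm.trans (h'.mono (le_max_right t t')).2

/-- The machine of a program computes what the program leaves on the output stack. -/
theorem Exec.outputsWithin [DecidableEq W] [Fintype W] {O : List Symb → List Symb}
    {c : StackProg W} {w : List Symb} {S' : Store W} {t : ℕ}
    (h : Exec O c (Function.update (fun _ => []) (Sum.inl Port.input) w) t S') :
    (machine c).OutputsWithin O w (t + 1) (S' (Sum.inl Port.output)) := by
  obtain ⟨n, hn, v', hv⟩ := h.reach (some c.entry)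
    (fun | none => none
         | some l => (instr c some none l).getLeft?)
    (fun | none => .halt
         | some l => Sum.elim (fun _ => .halt) id (instr c some none l)) some none
    (fun l y hl => by simp [hl]) (fun l p hl => by simp [hl]) none
  have h0 : (machine c).start w = ⟨some (some c.entry), none,
      toStk (Function.update (fun _ => []) (Sum.inl Port.input) w)⟩ := by
    unfold OracleTM.start
    congr 1
    funext j
    rcases j with (_ | _ | _ | _) | j <;> rfl
  have key : ((machine c).next O)^[n + 1] ((machine c).start w) = ⟨none, v', toStk S'⟩ := by
    rw [add_comm, Function.iterate_add_apply, Function.iterate_one]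
    rw [h0]
    exact congrArg ((machine c).next O) hv
  refine OracleTM.OutputsWithin.mono (t := n + 1) ⟨?_, ?_⟩ (by omega)
  · rw [key]
  · rw [key]; rfl

end StackProg

/-! ### Integers in signed binary notation -/

namespace Symb

/-- The value of a signed binary digit. -/
def dig : Symb → ℤ
  | one => 1
  | minus => -1
  | _ => 0

/-- The opposite digit. -/
def flip : Symb → Symb
  | one => minus
  | minus => one
  | s => s

/-- The lower digit in a two-digit representation of a number between `-3` and `3`. -/
def low (t : ℤ) : Symb := if t % 2 = 0 then zero else if 0 < t then one else minus

/-- The higher digit in a two-digit representation of a number between `-3` and `3`. -/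
def high (t : ℤ) : Symb := if 2 ≤ t then one else if t ≤ -2 then minus else zero

theorem abs_dig_le (s : Symb) : -1 ≤ dig s ∧ dig s ≤ 1 := by
  cases s <;> simp [dig]

theorem dig_low_add_high {t : ℤ} (h : -3 ≤ t) (h' : t ≤ 3) :
    dig (low t) + 2 * dig (high t) = t := by
  interval_cases t <;> decide

@[simp] theorem dig_flip (s : Symb) : dig (flip s) = -dig s := by
  cases s <;> simp [dig, flip]

/-- The value of the digit on top of a stack, `0` for the empty stack. -/
def odig (o : Option Symb) : ℤ := o.elim 0 dig

theorem abs_odig_le (o : Option Symb) : -1 ≤ odig o ∧ odig o ≤ 1 := by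
  cases o
  · simp [odig]
  · exact abs_dig_le _

/-- The integer denoted by a list of signed binary digits, least significant digit first. -/
def digitsVal : List Symb → ℤ
  | [] => 0
  | s :: l => dig s + 2 * digitsVal l

@[simp] theorem digitsVal_nil : digitsVal [] = 0 := rfl

@[simp] theorem digitsVal_cons (s : Symb) (l : List Symb) :
    digitsVal (s :: l) = dig s + 2 * digitsVal l := rfl

theorem digitsVal_append (l l' : List Symb) :
    digitsVal (l ++ l') = digitsVal l + 2 ^ l.length * digitsVal l' := by
  induction l with
  | nil => simp
  | cons s l ih =>
    simp only [List.cons_append, digitsVal_cons, ih, List.length_cons, pow_succ]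
    ring

@[simp] theorem digitsVal_map_flip (l : List Symb) : digitsVal (l.map flip) = -digitsVal l := by
  induction l with
  | nil => simp
  | cons s l ih => simp only [List.map_cons, digitsVal_cons, ih, dig_flip]; ring

theorem odig_head?_add (l : List Symb) : odig l.head? + 2 * digitsVal l.tail = digitsVal l := by
  cases l <;> simp [odig]

@[simp] theorem digitsVal_replicate_zero (n : ℕ) : digitsVal (List.replicate n zero) = 0 := by
  induction n with
  | zero => rfl
  | succ n ih => simp [List.replicate_succ, ih, dig]

end Symb

/-! ### The memory of the evaluation machine -/

/-- The work stacks of the evaluation machine: the coordinates of the point, the two factors `A`,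
`B` of the vector field, the operands `P`, `Q` and the result `R` of arithmetic operations, the
summand `H` for rounding, temporary stacks, a carry, a sign, the number of fractional bits of the
output, and a flag for the second coordinate of the point. -/
inductive Reg
  | U | V | A | B | P | Q | R | H | T | T' | carry | sign | len | flag
  deriving DecidableEq

instance : Fintype Reg :=
  ⟨{.U, .V, .A, .B, .P, .Q, .R, .H, .T, .T', .carry, .sign, .len, .flag}, fun s => by
    cases s <;> simp⟩

/-- The contents of all stacks of the evaluation machine. -/
structure Mem where
  input : List Symb
  query : List Symb
  answer : List Symb
  output : List Symb
  U : List Symb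
  V : List Symb
  A : List Symb
  B : List Symb
  P : List Symb
  Q : List Symb
  R : List Symb
  H : List Symb
  T : List Symb
  T' : List Symb
  carry : List Symb
  sign : List Symb
  len : List Symb
  flag : List Symb

namespace Mem

open StackProg

/-- The store with the given contents of the stacks. -/
def store (m : Mem) : Store Reg
  | .inl .input => m.input
  | .inl .query => m.query
  | .inl .answer => m.answer
  | .inl .output => m.output
  | .inr .U => m.U
  | .inr .V => m.V
  | .inr .A => m.A
  | .inr .B => m.B
  | .inr .P => m.P
  | .inr .Q => m.Q
  | .inr .R => m.R
  | .inr .H => m.H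
  | .inr .T => m.T
  | .inr .T' => m.T'
  | .inr .carry => m.carry
  | .inr .sign => m.sign
  | .inr .len => m.len
  | .inr .flag => m.flag

/-- Replace the contents of one stack. -/
def set (m : Mem) (k : Port ⊕ Reg) (l : List Symb) : Mem :=
  match k with
  | .inl .input => { m with input := l }
  | .inl .query => { m with query := l }
  | .inl .answer => { m with answer := l }
  | .inl .output => { m with output := l }
  | .inr .U => { m with U := l }
  | .inr .V => { m with V := l }
  | .inr .A => { m with A := l }
  | .inr .B => { m with B := l }
  | .inr .P => { m with P := l }
  | .inr .Q => { m with Q := l }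
  | .inr .R => { m with R := l }
  | .inr .H => { m with H := l }
  | .inr .T => { m with T := l }
  | .inr .T' => { m with T' := l }
  | .inr .carry => { m with carry := l }
  | .inr .sign => { m with sign := l }
  | .inr .len => { m with len := l }
  | .inr .flag => { m with flag := l }

theorem update_store (m : Mem) (k : Port ⊕ Reg) (l : List Symb) :
    Function.update m.store k l = (m.set k l).store := by
  funext j
  by_cases h : j = k
  · subst h
    rw [Function.update_self]
    rcases j with (_ | _ | _ | _) |
      (_ | _ | _ | _ | _ | _ | _ | _ | _ | _ | _ | _ | _ | _) <;> rfl
  · rw [Function.update_of_ne h]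
    rcases k with (_ | _ | _ | _) |
      (_ | _ | _ | _ | _ | _ | _ | _ | _ | _ | _ | _ | _ | _) <;>
    rcases j with (_ | _ | _ | _) |
      (_ | _ | _ | _ | _ | _ | _ | _ | _ | _ | _ | _ | _ | _) <;>
    first | rfl | exact absurd rfl h

/-- Execution of a program of the evaluation machine. -/
abbrev Run (O : List Symb → List Symb) (c : StackProg Reg) (m : Mem) (t : ℕ) (m' : Mem) : Prop :=
  Exec O c m.store t m'.store

variable {O : List Symb → List Symb}

theorem run_push (k : Port ⊕ Reg) (s : Symb) (m : Mem) :
    Run O (push k s) m 1 (m.set k (s :: m.store k)) := by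
  unfold Run
  rw [← update_store]
  exact .push ..

theorem run_push_of_eq {k : Port ⊕ Reg} {s : Symb} {m m' : Mem}
    (h : m.set k (s :: m.store k) = m') : Run O (push k s) m 1 m' :=
  h ▸ run_push k s m

theorem run_ask (m : Mem) : Run O ask m 1 { m with answer := O m.query, query := [] } := by
  have h := Exec.ask (O := O) m.store
  rw [update_store, update_store] at h
  exact h

theorem run_pop {k : Port ⊕ Reg} {br : Option Symb → StackProg Reg} {m m' : Mem} {t : ℕ}
    (h : Run O (br (m.store k).head?) (m.set k (m.store k).tail) t m') :
    Run O (pop k br) m (1 + t) m' := by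
  refine .pop ?_
  rw [update_store]
  exact h

theorem run_loop_nil {k : Port ⊕ Reg} {body : Symb → StackProg Reg} {m : Mem}
    (h : m.store k = []) : Run O (loop k body) m 1 m :=
  .loop_nil h

theorem run_loop_cons {k : Port ⊕ Reg} {body : Symb → StackProg Reg} {m m₁ m₂ : Mem} {s : Symb}
    {l : List Symb} {t₁ t₂ : ℕ} (h : m.store k = s :: l) (h₁ : Run O (body s) (m.set k l) t₁ m₁)
    (h₂ : Run O (loop k body) m₁ t₂ m₂) : Run O (loop k body) m (1 + t₁ + t₂) m₂ := by
  refine .loop_cons h ?_ h₂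
  rw [update_store]
  exact h₁

/-! ### Copying and clearing stacks -/

theorem exec_loop_push {a b : Port ⊕ Reg} (hab : a ≠ b) (f : Symb → Symb) (l : List Symb)
    (S : Store Reg) (h : S a = l) : Exec O (loop a fun s => push b (f s)) S (2 * l.length + 1)
      (Function.update (Function.update S a []) b ((l.map f).reverse ++ S b)) := by
  induction l generalizing S with
  | nil =>
    have : Function.update (Function.update S a []) b ((([] : List Symb).map f).reverse ++ S b)
        = S := by
      rw [← h, Function.update_eq_self, h]; simp
    rw [this]
    exact .loop_nil h
  | cons s l ih =>
    have h' := ih (Function.update (Function.update S a l) b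
      (f s :: Function.update S a l b)) (by simp [hab])
    refine .weaken (.loop_cons h (.push ..) ?_) (t := 1 + 1 + (2 * l.length + 1)) (by simp; omega)
    convert h' using 1
    rw [Function.update_comm hab.symm]
    simp [Function.update_of_ne hab.symm]

/-- Move the contents of a stack to another one, in reverse order, applying a map to the symbols. -/
def move (a b : Port ⊕ Reg) (f : Symb → Symb := id) : StackProg Reg := loop a fun s => push b (f s)

theorem run_move {a b : Port ⊕ Reg} (hab : a ≠ b) (f : Symb → Symb) (m : Mem) :
    Run O (move a b f) m (2 * (m.store a).length + 1)
      ((m.set a []).set b (((m.store a).map f).reverse ++ m.store b)) := by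
  have h := exec_loop_push (O := O) hab f _ m.store rfl
  rw [update_store, update_store] at h
  exact h

theorem run_move_of_eq {a b : Port ⊕ Reg} (hab : a ≠ b) {f : Symb → Symb} {m m' : Mem}
    (h : (m.set a []).set b (((m.store a).map f).reverse ++ m.store b) = m') :
    Run O (move a b f) m (2 * (m.store a).length + 1) m' :=
  h ▸ run_move hab f m

theorem run_clear {a : Port ⊕ Reg} (l : List Symb) (m : Mem) (h : m.store a = l) :
    Run O (loop a fun _ => skip) m (2 * l.length + 1) (m.set a []) := by
  unfold Run
  rw [← update_store]
  generalize m.store = S at *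
  induction l generalizing S with
  | nil => rw [← h, Function.update_eq_self]; exact .weaken (.loop_nil h) (by omega)
  | cons s l ih =>
    have h' := ih (Function.update S a l) (by simp)
    rw [Function.update_idem] at h'
    exact .weaken (.loop_cons h (.skip _) h') (by simp; omega)

theorem exec_loop_push_push {a b c : Port ⊕ Reg} (hab : a ≠ b) (hac : a ≠ c) (hbc : b ≠ c)
    (f : Symb → Symb) (l : List Symb) (S : Store Reg) (h : S a = l) :
    Exec O (loop a fun s => push b s ;; push c (f s)) S (3 * l.length + 1)
      (Function.update (Function.update (Function.update S a []) b (l.reverse ++ S b)) c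
        ((l.map f).reverse ++ S c)) := by
  induction l generalizing S with
  | nil =>
    have : Function.update (Function.update (Function.update S a []) b ([].reverse ++ S b)) c
        ((([] : List Symb).map f).reverse ++ S c) = S := by
      rw [← h, Function.update_eq_self, h]; simp
    rw [this]
    exact .loop_nil h
  | cons s l ih =>
    have h' := ih (Function.update (Function.update (Function.update S a l) b (s :: S b)) c
      (f s :: S c)) (by simp [hab, hac])
    have h1 : Exec O (push b s ;; push c (f s)) (Function.update S a l) (1 + 1)
        (Function.update (Function.update (Function.update S a l) b (s :: S b)) c
          (f s :: S c)) := by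
      convert Exec.seq (.push b s _) (.push c (f s) _) using 1
      simp [Function.update_of_ne hab.symm, Function.update_of_ne hac.symm,
        Function.update_of_ne hbc.symm]
    refine .weaken (.loop_cons h h1 ?_) (t := 1 + (1 + 1) + (3 * l.length + 1)) (by simp; omega)
    convert h' using 1
    funext j
    simp only [Function.update_apply]
    split_ifs <;> simp_all

/-- Copy a stack onto another one, applying a map to the symbols. -/
def copy (a c : Port ⊕ Reg) (f : Symb → Symb := id) : StackProg Reg :=
  move a (.inr .T) ;; loop (.inr .T) fun s => push a s ;; push c (f s)

theorem run_copy {a c : Port ⊕ Reg} (hac : a ≠ c) (ha : a ≠ .inr .T) (hc : c ≠ .inr .T)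
    (f : Symb → Symb) (m : Mem) (hT : m.T = []) :
    Run O (copy a c f) m (5 * (m.store a).length + 2)
      (m.set c ((m.store a).map f ++ m.store c)) := by
  have h1 := exec_loop_push (O := O) ha id _ m.store rfl
  have h2 := exec_loop_push_push (O := O) ha.symm hc.symm hac f (m.store a).reverse
    (Function.update (Function.update m.store a []) (.inr .T)
      (((m.store a).map id).reverse ++ m.store (.inr .T))) (by
        have : m.store (.inr .T) = [] := hT
        simp [this])
  unfold Run
  rw [← update_store]
  refine .weaken (.seq h1 ?_) (t := 2 * (m.store a).length + 1 + (3 * (m.store a).length + 1))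
    (by omega)
  convert h2 using 1
  · simp
  have hT' : m.store (.inr .T) = [] := hT
  funext j
  simp only [Function.update_apply]
  split_ifs <;> simp_all

end Mem

open StackProg Symb Mem

variable {O : List Symb → List Symb}

/-! ### Addition -/

/-- Add digit by digit a multiple of `P` to `R`, for the digits of `P`. -/
def addDigits (d : Symb) : StackProg Reg :=
  loop (.inr .P) fun x => push (.inr .T) x ;; pop (.inr .R) fun y => pop (.inr .carry) fun z =>
    push (.inr .T') (low (dig d * dig x + odig y + odig z)) ;;
    push (.inr .carry) (high (dig d * dig x + odig y + odig z))

theorem run_addDigits (d z : Symb) (m : Mem) (p r t t' : List Symb) :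
    ∃ (w : List Symb) (z' : Symb),
      Run O (addDigits d) { m with P := p, R := r, T := t, T' := t', carry := [z] }
        (6 * p.length + 1)
        { m with P := [], R := r.drop p.length, T := p.reverse ++ t, T' := w.reverse ++ t',
                 carry := [z'] } ∧
      w.length = p.length ∧
      digitsVal w + 2 ^ p.length * (dig z' + digitsVal (r.drop p.length)) =
        dig d * digitsVal p + digitsVal r + dig z := by
  induction p generalizing z r t t' with
  | nil => exact ⟨[], z, run_loop_nil rfl, rfl, by simp; ring⟩
  | cons x p ih =>
    set s := dig d * dig x + odig r.head? + dig z with hs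
    obtain ⟨w, z', h, hl, hv⟩ := ih (high s) r.tail (x :: t) (low s :: t')
    refine ⟨low s :: w, z', ?_, by simp [hl], ?_⟩
    · rw [List.drop_tail] at h
      simp only [List.length_cons, List.reverse_cons, List.append_assoc, List.singleton_append]
      refine Exec.weaken (t := 1 + (1 + (1 + (1 + (1 + 1)))) + (6 * p.length + 1)) ?_ (by omega)
      refine run_loop_cons rfl ?_ h
      refine .seq (run_push _ _ _) ?_
      refine run_pop ?_
      refine run_pop ?_
      refine .seq (run_push _ _ _) ?_
      exact run_push_of_eq (by simp only [Mem.set, Mem.store]; rfl)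
    · have h1 : dig (low s) + 2 * dig (high s) = s := by
        have h2 := abs_dig_le d
        have h3 := abs_dig_le x
        have h4 := abs_dig_le z
        have h5 := abs_odig_le r.head?
        apply dig_low_add_high
        · nlinarith
        · nlinarith
      have h2 := odig_head?_add r
      simp only [digitsVal_cons, List.length_cons, pow_succ]
      rw [List.drop_tail] at hv
      linear_combination h2 + h1 + hs + 2 * hv

/-- Add digit by digit the carry to `R`. -/
def addRest : StackProg Reg :=
  loop (.inr .R) fun y => pop (.inr .carry) fun z =>
    push (.inr .T') (low (dig y + odig z)) ;; push (.inr .carry) (high (dig y + odig z))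

theorem run_addRest (z : Symb) (m : Mem) (r t' : List Symb) :
    ∃ (w : List Symb) (z' : Symb),
      Run O addRest { m with R := r, T' := t', carry := [z] } (4 * r.length + 1)
        { m with R := [], T' := w.reverse ++ t', carry := [z'] } ∧
      w.length = r.length ∧
      digitsVal w + 2 ^ r.length * dig z' = digitsVal r + dig z := by
  induction r generalizing z t' with
  | nil => exact ⟨[], z, run_loop_nil rfl, rfl, by simp⟩
  | cons y r ih =>
    set s := dig y + dig z with hs
    obtain ⟨w, z', h, hl, hv⟩ := ih (high s) (low s :: t')
    refine ⟨low s :: w, z', ?_, by simp [hl], ?_⟩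
    · simp only [List.length_cons, List.reverse_cons, List.append_assoc, List.singleton_append]
      refine Exec.weaken (t := 1 + (1 + (1 + 1)) + (4 * r.length + 1)) ?_ (by omega)
      refine run_loop_cons rfl ?_ h
      refine run_pop ?_
      refine .seq (run_push _ _ _) ?_
      exact run_push_of_eq (by simp only [Mem.set, Mem.store]; rfl)
    · have h1 : dig (low s) + 2 * dig (high s) = s := by
        have h3 := abs_dig_le y
        have h4 := abs_dig_le z
        apply dig_low_add_high <;> omega
      simp only [digitsVal_cons, List.length_cons, pow_succ]
      linear_combination h1 + hs + 2 * hv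

/-- Add `d` times `P` to `R`. -/
def addScaled (d : Symb) : StackProg Reg :=
  push (.inr .carry) zero ;; addDigits d ;; addRest ;;
    pop (.inr .carry) (fun z => push (.inr .T') (z.getD zero)) ;;
    move (.inr .T') (.inr .R) ;; move (.inr .T) (.inr .P)

theorem run_addScaled (d : Symb) (m : Mem) (hT : m.T = []) (hT' : m.T' = [])
    (hc : m.carry = []) :
    ∃ r : List Symb, Run O (addScaled d) m (20 * (m.P.length + m.R.length + 1))
        { m with R := r } ∧ r.length ≤ max m.P.length m.R.length + 1 ∧
      digitsVal r = dig d * digitsVal m.P + digitsVal m.R := by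
  obtain ⟨inp, qu, an, ou, U, V, A, B, p, Q, r, H, T, T', ca, sg, le, fl⟩ := m
  simp only at hT hT' hc
  subst hT hT' hc
  obtain ⟨w, z, h, hl, hv⟩ := run_addDigits (O := O) d zero
    ⟨inp, qu, an, ou, U, V, A, B, p, Q, r, H, [], [], [], sg, le, fl⟩ p r [] []
  obtain ⟨w', z', h', hl', hv'⟩ := run_addRest (O := O) z
    ⟨inp, qu, an, ou, U, V, A, B, [], Q, r, H, p.reverse, [], [], sg, le, fl⟩
      (r.drop p.length) w.reverse
  simp only [List.append_nil] at h
  refine ⟨w ++ w' ++ [z'], ?_, ?_, ?_⟩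
  · refine Exec.weaken (.seq (run_push _ _ _) (.seq h (.seq h' (.seq (run_pop (run_push _ _ _))
      (.seq (run_move (by decide) _ _) ?_)))))
      (t := 1 + (6 * p.length + 1 + (4 * (r.drop p.length).length + 1 + (1 + 1 +
        (2 * (z' :: (w'.reverse ++ w.reverse)).length + 1 + (2 * p.reverse.length + 1)))))) ?_
    · refine .weaken (run_move_of_eq (by decide) ?_) ?_
      · simp [Mem.set, Mem.store]
      · simp [Mem.set, Mem.store]
    · simp [hl, hl']; omega
  · simp [hl, hl']; omega
  · rw [digitsVal_append, digitsVal_append]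
    simp only [List.length_append, digitsVal_cons, digitsVal_nil, hl, hl', pow_add] at *
    have : dig zero = 0 := rfl
    rw [this] at hv
    linear_combination hv + 2 ^ p.length * hv'

/-! ### Multiplication -/

/-- Add the product of `P` and `Q` to `R`. -/
def addMul : StackProg Reg :=
  (loop (.inr .Q) fun d => addScaled d ;; push (.inr .P) zero) ;; loop (.inr .P) fun _ => skip

theorem run_addMul_loop (X : ℕ) (q : List Symb) (m : Mem) (hT : m.T = []) (hT' : m.T' = [])
    (hc : m.carry = []) (hX : m.P.length + 2 * q.length ≤ X) (hX' : m.R.length + q.length ≤ X) :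
    ∃ p r : List Symb, Run O (loop (.inr .Q) fun d => addScaled d ;; push (.inr .P) zero)
        { m with Q := q } (q.length * (40 * X + 22) + 1) { m with Q := [], P := p, R := r } ∧
      p.length = m.P.length + q.length ∧ r.length ≤ X ∧
      digitsVal r = digitsVal m.R + digitsVal m.P * digitsVal q := by
  induction q generalizing m with
  | nil => exact ⟨m.P, m.R, .weaken (run_loop_nil rfl) (by simp), rfl, by simpa using hX', by simp⟩
  | cons d q ih =>
    simp only [List.length_cons] at hX hX' ⊢
    obtain ⟨r₁, h₁, hl₁, hv₁⟩ := run_addScaled (O := O) d { m with Q := q } hT hT' hc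
    simp only at hl₁ hv₁ h₁
    obtain ⟨p, r, h, hp, hr, hv⟩ := ih { m with P := zero :: m.P, R := r₁ } hT hT' hc
      (by simp; omega) (by simp; omega)
    simp only [List.length_cons] at hp
    refine ⟨p, r, ?_, by omega, hr, ?_⟩
    · refine Exec.weaken (run_loop_cons rfl (.seq h₁ (run_push_of_eq ?_)) h) ?_
      · rfl
      · have : (q.length + 1) * (40 * X + 22) = q.length * (40 * X + 22) + 40 * X + 22 := by ring
        omega
    · rw [hv]
      simp only [digitsVal_cons, hv₁]
      have : dig zero = 0 := rfl
      rw [this]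
      ring

theorem run_addMul (m : Mem) (hT : m.T = []) (hT' : m.T' = []) (hc : m.carry = []) :
    ∃ r : List Symb, Run O addMul m (100 * (m.P.length + 2 * m.Q.length + m.R.length + 1) ^ 2)
        { m with P := [], Q := [], R := r } ∧
      r.length ≤ m.P.length + 2 * m.Q.length + m.R.length ∧
      digitsVal r = digitsVal m.R + digitsVal m.P * digitsVal m.Q := by
  set X := m.P.length + 2 * m.Q.length + m.R.length with hX
  obtain ⟨p, r, h, hp, hr, hv⟩ := run_addMul_loop (O := O) X m.Q m hT hT' hc (by omega) (by omega)
  refine ⟨r, ?_, hr, hv⟩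
  refine Exec.weaken (.seq h (run_clear p _ rfl)) ?_
  have : m.Q.length * (40 * X + 22) ≤ X * (40 * X + 22) := Nat.mul_le_mul_right _ (by omega)
  nlinarith

/-! ### Sign and binary digits -/

open DyadicString (bitSymb natOfBits)

theorem natOfBits_append_singleton (l : List Bool) (b : Bool) :
    natOfBits (l ++ [b]) = 2 * natOfBits l + b.toNat := by
  simp [natOfBits]

theorem dig_bitSymb (b : Bool) : dig (bitSymb b) = b.toNat := by
  cases b <;> rfl

theorem digitsVal_bits (l : List Bool) :
    digitsVal ((l.map bitSymb).reverse) = natOfBits l := by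
  induction l using List.reverseRecOn with
  | nil => rfl
  | append_singleton l b ih =>
    rw [List.map_append, List.reverse_append, natOfBits_append_singleton]
    simp only [List.map_cons, List.map_nil, List.reverse_singleton, List.singleton_append,
      digitsVal_cons, ih, dig_bitSymb]
    push_cast
    ring

theorem natOfBits_lt (l : List Bool) : natOfBits l < 2 ^ l.length := by
  induction l using List.reverseRecOn with
  | nil => simp [natOfBits]
  | append_singleton l b ih =>
    rw [natOfBits_append_singleton, List.length_append, List.length_singleton, pow_succ]
    have := Bool.toNat_le b
    omega

/-- The leading nonzero digit. -/
def lead : List Symb → Symb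
  | [] => zero
  | x :: l => if lead l ≠ zero then lead l else if dig x = 0 then zero else x

theorem lead_cases (l : List Symb) : (lead l = zero ∧ digitsVal l = 0) ∨
    (lead l = one ∧ 0 < digitsVal l) ∨ (lead l = minus ∧ digitsVal l < 0) := by
  induction l with
  | nil => simp [lead]
  | cons x l ih =>
    have hx := abs_dig_le x
    simp only [lead, digitsVal_cons]
    rcases ih with ⟨h, h'⟩ | ⟨h, h'⟩ | ⟨h, h'⟩
    · cases x <;> simp [h, h', dig]
    · simp [h]; omega
    · simp [h]; omega

/-- Replace the digits on `R` by digits for the absolute value, and put the sign on `sign`. The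
loop finds the leading nonzero digit, whose sign is that of the number. -/
def splitSign : StackProg Reg :=
  push (.inr .sign) zero ;;
  (loop (.inr .R) fun x => push (.inr .T') x ;;
    pop (.inr .sign) fun s => push (.inr .sign) (if dig x = 0 then s.getD zero else x)) ;;
  pop (.inr .sign) fun s =>
    if s = some minus then push (.inr .sign) minus ;; move (.inr .T') (.inr .R) flip
    else push (.inr .sign) plus ;; move (.inr .T') (.inr .R)

theorem run_splitSign_loop (s : Symb) (r t' : List Symb) (m : Mem) :
    Run O (loop (.inr .R) fun x => push (.inr .T') x ;;
      pop (.inr .sign) fun s => push (.inr .sign) (if dig x = 0 then s.getD zero else x))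
      { m with R := r, T' := t', sign := [s] } (4 * r.length + 1)
      { m with R := [], T' := r.reverse ++ t',
               sign := [if lead r = zero then s else lead r] } := by
  induction r generalizing s t' with
  | nil => exact run_loop_nil rfl
  | cons x r ih =>
    have h := ih (if dig x = 0 then s else x) (x :: t')
    simp only [List.length_cons, List.reverse_cons, List.append_assoc, List.singleton_append]
    have e : (if lead r = zero then (if dig x = 0 then s else x) else lead r) =
        (if lead (x :: r) = zero then s else lead (x :: r)) := by
      rcases lead_cases r with ⟨h2, -⟩ | ⟨h2, -⟩ | ⟨h2, -⟩ <;> cases x <;> simp [lead, h2, dig]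
    rw [e] at h
    refine .weaken (run_loop_cons rfl ?_ h) (t := 1 + (1 + (1 + 1)) + (4 * r.length + 1)) (by omega)
    refine .seq (run_push _ _ _) ?_
    refine run_pop ?_
    exact run_push_of_eq (by simp only [Mem.set, Mem.store]; rfl)

theorem run_splitSign (m : Mem) (hT' : m.T' = []) (hs : m.sign = []) :
    ∃ r : List Symb, Run O splitSign m (6 * m.R.length + 5)
        { m with R := r, sign := [if digitsVal m.R < 0 then minus else plus] } ∧
      r.length = m.R.length ∧ digitsVal r = |digitsVal m.R| := by
  obtain ⟨inp, qu, an, ou, U, V, A, B, p, Q, r, H, T, T', ca, sg, le, fl⟩ := m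
  simp only at hT' hs
  subst hT' hs
  have h := run_splitSign_loop (O := O) zero r []
    ⟨inp, qu, an, ou, U, V, A, B, p, Q, r, H, T, [], ca, [], le, fl⟩
  have e : (if lead r = zero then zero else lead r) = lead r := by split_ifs with h <;> simp [h]
  rw [e] at h
  simp only [List.append_nil] at h ⊢
  by_cases hv : digitsVal r < 0
  · have hl : lead r = minus := by
      rcases lead_cases r with ⟨_, h2⟩ | ⟨_, h2⟩ | ⟨h1, h2⟩
      · omega
      · omega
      · exact h1
    refine ⟨r.map flip, ?_, by simp, by rw [digitsVal_map_flip, abs_of_neg hv]⟩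
    refine .weaken (.seq (run_push _ _ _) (.seq h (run_pop ?_)))
      (t := 1 + (4 * r.length + 1 + (1 + (1 + (2 * r.reverse.length + 1)))))
      (by simp; omega)
    simp only [Mem.store, hl, List.head?_cons, if_true, hv]
    refine .seq (run_push _ _ _) (run_move_of_eq (by decide) ?_)
    simp [Mem.set, Mem.store]
  · have hl : lead r ≠ minus := by
      rcases lead_cases r with ⟨h1, h2⟩ | ⟨h1, h2⟩ | ⟨h1, h2⟩
      · simp [h1]
      · simp [h1]
      · omega
    refine ⟨r, ?_, rfl, by rw [abs_of_nonneg (by omega)]⟩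
    refine .weaken (.seq (run_push _ _ _) (.seq h (run_pop ?_)))
      (t := 1 + (4 * r.length + 1 + (1 + (1 + (2 * r.reverse.length + 1)))))
      (by simp; omega)
    simp only [Mem.store, List.head?_cons, Option.some.injEq, hl, if_false, hv]
    refine .seq (run_push _ _ _) (run_move_of_eq (by decide) ?_)
    simp [Mem.set, Mem.store]

/-- Convert the nonnegative number on `R` from signed to usual binary digits, without leading
zeros. The first loop propagates borrows, stored on `carry`, from the least significant digit
upwards; the second one rebuilds the stack from the most significant digit, and pushes a `0` only
onto a nonempty stack. -/
def toBinary : StackProg Reg :=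
  push (.inr .carry) zero ;;
  (loop (.inr .R) fun x => pop (.inr .carry) fun z =>
    push (.inr .T') (bitSymb ((dig x + odig z) % 2 = 1)) ;;
    push (.inr .carry) (if dig x + odig z < 0 then minus else zero)) ;;
  pop (.inr .carry) (fun _ => skip) ;;
  loop (.inr .T') fun x => if x = one then push (.inr .R) one else
    pop (.inr .R) fun y => match y with
      | none => skip
      | some y => push (.inr .R) y ;; push (.inr .R) zero

theorem run_toBinary_loop (c : Bool) (r t' : List Symb) (m : Mem) :
    ∃ (w : List Bool) (c' : Bool), Run O (loop (.inr .R) fun x => pop (.inr .carry) fun z =>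
      push (.inr .T') (bitSymb ((dig x + odig z) % 2 = 1)) ;;
      push (.inr .carry) (if dig x + odig z < 0 then minus else zero))
      { m with R := r, T' := t', carry := [if c then minus else zero] } (4 * r.length + 1)
      { m with R := [], T' := w.map bitSymb ++ t',
               carry := [if c' then minus else zero] } ∧ w.length = r.length ∧
      (natOfBits w : ℤ) - 2 ^ r.length * c'.toNat = digitsVal r - c.toNat := by
  induction r generalizing c t' with
  | nil => exact ⟨[], c, run_loop_nil rfl, rfl, by simp [natOfBits]⟩
  | cons x r ih =>
    set s : ℤ := dig x - c.toNat with hs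
    have hx := abs_dig_le x
    have hc := Bool.toNat_le c
    have e : dig x + odig (some (if c then minus else zero)) = s := by
      cases c <;> simp [s, odig, dig, sub_eq_add_neg]
    obtain ⟨w, c', h, hl, hv⟩ := ih (decide (s < 0)) (bitSymb (s % 2 = 1) :: t')
    refine ⟨w ++ [decide (s % 2 = 1)], c', ?_, by simp [hl], ?_⟩
    · simp only [List.length_cons, List.map_append, List.map_cons, List.map_nil,
        List.append_assoc, List.singleton_append]
      refine .weaken (run_loop_cons rfl ?_ h) (t := 1 + (1 + (1 + 1)) + (4 * r.length + 1))
        (by omega)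
      refine run_pop ?_
      simp only [Mem.set, Mem.store, List.head?_cons, List.tail_cons, e]
      refine .seq (run_push _ _ _) ?_
      exact run_push_of_eq (by simp [Mem.set, Mem.store])
    · rw [natOfBits_append_singleton]
      simp only [List.length_cons, pow_succ, digitsVal_cons]
      have h1 : ((decide (s % 2 = 1)).toNat : ℤ) - 2 * (decide (s < 0)).toNat = s := by
        have : -2 ≤ s ∧ s ≤ 1 := by omega
        obtain ⟨h1, h2⟩ := this
        generalize s = u at *
        interval_cases u <;> simp
      push_cast
      linear_combination h1 + hs + 2 * hv

theorem bits_two_mul_add (v : ℕ) (b : Bool) (h : v = 0 → b = true) :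
    (2 * v + b.toNat).bits = b :: v.bits := by
  cases b
  · simpa using Nat.bit0_bits v (fun h' => by simpa using h h')
  · simp

theorem run_strip_loop (v : ℕ) (l : List Bool) (m : Mem) :
    Run O (loop (.inr .T') fun x => if x = one then push (.inr .R) one else
      pop (.inr .R) fun y => match y with
        | none => skip
        | some y => push (.inr .R) y ;; push (.inr .R) zero)
      { m with R := v.bits.map bitSymb, T' := l.map bitSymb } (4 * l.length + 1)
      { m with R := (l.foldl (fun a b => 2 * a + b.toNat) v).bits.map bitSymb, T' := [] } := by
  induction l generalizing v with
  | nil => exact run_loop_nil rfl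
  | cons b l ih =>
    have h := ih (2 * v + b.toNat)
    simp only [List.length_cons, List.foldl_cons]
    refine .weaken (run_loop_cons rfl ?_ h) (t := 1 + 3 + (4 * l.length + 1)) (by omega)
    cases b
    · rw [if_neg (by decide)]
      rcases Nat.eq_zero_or_pos v with rfl | hv
      · refine .weaken (run_pop (t := 1) ?_) (by omega)
        simp only [Mem.set, Mem.store, Nat.zero_bits, List.map_nil]
        exact .skip _
      · rw [bits_two_mul_add v false (by omega)]
        refine run_pop (t := 2) ?_
        simp only [Mem.set, Mem.store]
        rcases hb : v.bits with _ | ⟨b', l'⟩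
        · have := Nat.digits_two_eq_bits v
          rw [hb] at this
          simp only [List.map_nil] at this
          have := Nat.digits_eq_nil_iff_eq_zero.1 this
          omega
        · simp only [List.map_cons, List.head?_cons, List.tail_cons]
          refine .seq (run_push _ _ _) (run_push_of_eq ?_)
          simp only [Mem.set, Mem.store]
          rfl
    · rw [bits_two_mul_add v true (by simp), if_pos (by decide)]
      exact .weaken (run_push_of_eq (by simp only [Mem.set, Mem.store]; rfl)) (by omega)

theorem run_toBinary (m : Mem) (hT' : m.T' = []) (hc : m.carry = []) (h0 : 0 ≤ digitsVal m.R) :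
    Run O toBinary m (8 * m.R.length + 5)
      { m with R := (digitsVal m.R).toNat.bits.map bitSymb } := by
  obtain ⟨inp, qu, an, ou, U, V, A, B, p, Q, r, H, T, T', ca, sg, le, fl⟩ := m
  simp only at hT' hc
  subst hT' hc
  obtain ⟨w, c, h, hl, hv⟩ := run_toBinary_loop (O := O) false r []
    ⟨inp, qu, an, ou, U, V, A, B, p, Q, r, H, T, [], [], sg, le, fl⟩
  have h' := run_strip_loop (O := O) 0 w
    ⟨inp, qu, an, ou, U, V, A, B, p, Q, [], H, T, [], [], sg, le, fl⟩
  have e : (digitsVal r).toNat = w.foldl (fun a b => 2 * a + b.toNat) 0 := by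
    change _ = natOfBits w
    have h1 := natOfBits_lt w
    rw [hl] at h1
    have h2 : (natOfBits w : ℤ) < 2 ^ r.length := by exact_mod_cast h1
    have h0' : 0 ≤ digitsVal r := h0
    cases c
    · simp at hv; omega
    · simp at hv; omega
  simp only [List.append_nil, Nat.zero_bits, List.map_nil] at h h' ⊢
  rw [e]
  refine .weaken (.seq (run_push _ _ _) (.seq h (.seq (run_pop (.skip _)) ?_)))
    (t := 1 + (4 * r.length + 1 + (1 + 1 + (4 * w.length + 1)))) (by simp; omega)
  simp only [Mem.set, Mem.store, List.tail_cons]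
  exact h'

/-! ### Writing a dyadic number -/

/-- The `n` lowest binary digits of a number, least significant digit first. -/
def lowBits : ℕ → ℕ → List Bool
  | 0, _ => []
  | n + 1, x => decide (x % 2 = 1) :: lowBits n (x / 2)

@[simp] theorem length_lowBits (n x : ℕ) : (lowBits n x).length = n := by
  induction n generalizing x with
  | zero => rfl
  | succ n ih => simp [lowBits, ih]

theorem bits_eq_cons {x : ℕ} (h : x ≠ 0) : x.bits = decide (x % 2 = 1) :: (x / 2).bits := by
  have h1 : 2 * (x / 2) + (decide (x % 2 = 1)).toNat = x := by
    rcases Nat.mod_two_eq_zero_or_one x with h2 | h2 <;> simp [h2] <;> omega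
  have h2 := bits_two_mul_add (x / 2) (decide (x % 2 = 1)) (fun h0 => by simp; omega)
  rwa [h1] at h2

theorem tail_bits (x : ℕ) : x.bits.tail = (x / 2).bits := by
  rcases eq_or_ne x 0 with rfl | h
  · simp
  · rw [bits_eq_cons h, List.tail_cons]

theorem head?_bits (x : ℕ) : (x.bits.map bitSymb).head?.getD zero = bitSymb (x % 2 = 1) := by
  rcases eq_or_ne x 0 with rfl | h
  · rfl
  · rw [bits_eq_cons h]; rfl

/-- The canonical string for the integer part of a number. -/
def intBits (y : ℕ) : List Bool := if y = 0 then [false] else y.bits.reverse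

theorem natOfBits_reverse_bits (y : ℕ) : natOfBits y.bits.reverse = y := by
  induction y using Nat.strong_induction_on with
  | _ y ih =>
    rcases eq_or_ne y 0 with rfl | h
    · rfl
    · rw [bits_eq_cons h, List.reverse_cons, natOfBits_append_singleton, ih _ (by omega)]
      rcases Nat.mod_two_eq_zero_or_one y with h2 | h2 <;> simp [h2] <;> omega

theorem natOfBits_intBits (y : ℕ) : natOfBits (intBits y) = y := by
  unfold intBits
  split_ifs with h
  · rw [h]; rfl
  · exact natOfBits_reverse_bits y

theorem getLast?_bits {y : ℕ} (h : y ≠ 0) : y.bits.getLast? = some true := by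
  induction y using Nat.strong_induction_on with
  | _ y ih =>
    rw [bits_eq_cons h]
    rcases eq_or_ne (y / 2) 0 with h2 | h2
    · have : y = 1 := by omega
      subst this
      simp
    · have h3 := ih (y / 2) (by omega) h2
      rw [List.getLast?_cons, h3]
      rfl

/-- The canonical dyadic string for `±x / 2 ^ n`. -/
def mkDyadic (neg : Bool) (x n : ℕ) : DyadicString where
  neg := neg
  int := intBits (x / 2 ^ n)
  frac := (lowBits n x).reverse
  int_ne_nil := by
    unfold intBits
    split_ifs with h
    · simp
    · rw [bits_eq_cons h]; simp
  leading := by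
    intro hl
    unfold intBits at hl ⊢
    split_ifs at hl ⊢ with h
    · simp at hl
    · rw [List.head?_reverse, getLast?_bits h]

theorem natOfBits_append_lowBits (l : List Bool) (n x : ℕ) (h : natOfBits l = x / 2 ^ n) :
    natOfBits (l ++ (lowBits n x).reverse) = x := by
  induction n generalizing x with
  | zero => simpa [lowBits] using h
  | succ n ih =>
    rw [lowBits, List.reverse_cons, ← List.append_assoc, natOfBits_append_singleton,
      ih (x / 2) (by rw [h, pow_succ', Nat.div_div_eq_div_mul])]
    rcases Nat.mod_two_eq_zero_or_one x with h2 | h2 <;> simp [h2] <;> omega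

theorem prec_mkDyadic (neg : Bool) (x n : ℕ) : (mkDyadic neg x n).prec = n := by
  simp [DyadicString.prec, mkDyadic]

theorem value_mkDyadic (neg : Bool) (x n : ℕ) :
    (mkDyadic neg x n).value = (if neg then -1 else 1) * (x : ℝ) / 2 ^ n := by
  unfold DyadicString.value
  have h1 : (mkDyadic neg x n).frac.length = n := prec_mkDyadic neg x n
  have h2 : natOfBits ((mkDyadic neg x n).int ++ (mkDyadic neg x n).frac) = x :=
    natOfBits_append_lowBits _ n x (natOfBits_intBits _)
  rw [h1, h2]
  rfl

/-- Remove as many binary digits from `R` as there are symbols on `P`. -/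
def dropDigits : StackProg Reg := loop (.inr .P) fun _ => pop (.inr .R) fun _ => skip

theorem run_dropDigits (x : ℕ) (p : List Symb) (m : Mem) :
    Run O dropDigits { m with P := p, R := x.bits.map bitSymb } (3 * p.length + 1)
      { m with P := [], R := (x / 2 ^ p.length).bits.map bitSymb } := by
  induction p generalizing x with
  | nil =>
    simp only [List.length_nil, pow_zero, Nat.div_one]
    exact run_loop_nil rfl
  | cons s p ih =>
    have h := ih (x / 2)
    rw [Nat.div_div_eq_div_mul, ← pow_succ'] at h
    simp only [List.length_cons]
    refine .weaken (run_loop_cons rfl ?_ h) (t := 1 + (1 + 1) + (3 * p.length + 1)) (by omega)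
    refine run_pop ?_
    simp only [Mem.set, Mem.store]
    rw [← List.map_tail, tail_bits]
    exact .skip _

/-- Write the fractional digits. -/
def emitFrac : StackProg Reg :=
  loop (.inr .len) fun s => push (.inr .T) s ;;
    pop (.inr .R) fun o => push (.inl .output) (o.getD zero)

theorem run_emitFrac (x : ℕ) (l t o : List Symb) (m : Mem) :
    Run O emitFrac { m with len := l, T := t, R := x.bits.map bitSymb, output := o }
      (4 * l.length + 1)
      { m with len := [], T := l.reverse ++ t, R := (x / 2 ^ l.length).bits.map bitSymb,
               output := (lowBits l.length x).reverse.map bitSymb ++ o } := by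
  induction l generalizing x t o with
  | nil =>
    simp only [List.length_nil, pow_zero, Nat.div_one]
    exact run_loop_nil rfl
  | cons s l ih =>
    have h := ih (x / 2) (s :: t) (bitSymb (x % 2 = 1) :: o)
    rw [Nat.div_div_eq_div_mul, ← pow_succ'] at h
    simp only [List.length_cons, List.reverse_cons, List.append_assoc, List.singleton_append,
      lowBits, List.map_append, List.map_cons, List.map_nil]
    refine .weaken (run_loop_cons rfl ?_ h) (t := 1 + (1 + (1 + 1)) + (4 * l.length + 1))
      (by omega)
    refine .seq (run_push _ _ _) ?_
    refine run_pop ?_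
    refine run_push_of_eq ?_
    simp only [Mem.set, Mem.store, ← List.map_tail, tail_bits, head?_bits]

/-- Write the number on `R`, with `len` fractional digits and the sign on `sign`. -/
def emit : StackProg Reg :=
  push (.inl .output) sep ;; emitFrac ;; move (.inr .T) (.inr .len) ;;
  push (.inl .output) point ;;
  (pop (.inr .R) fun o => match o with
    | none => push (.inl .output) zero
    | some s => push (.inl .output) s ;; move (.inr .R) (.inl .output)) ;;
  pop (.inr .sign) fun s => push (.inl .output) (s.getD plus)

theorem run_emit (neg : Bool) (x : ℕ) (m : Mem) (hT : m.T = [])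
    (hs : m.sign = [if neg then minus else plus]) (hR : m.R = x.bits.map bitSymb) :
    Run O emit m (6 * m.len.length + 2 * m.R.length + 10)
      { m with R := [], sign := [], output :=
        (mkDyadic neg x m.len.length).encode ++ sep :: m.output } := by
  obtain ⟨inp, qu, an, ou, U, V, A, B, p, Q, r, H, T, T', ca, sg, le, fl⟩ := m
  simp only at hT hs hR
  subst hT hs hR
  have h := run_emitFrac (O := O) x le [] (sep :: ou)
    ⟨inp, qu, an, ou, U, V, A, B, p, Q, [], H, [], T', ca, [if neg then minus else plus], le, fl⟩
  simp only [List.append_nil] at h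
  have hneg : (if neg then minus else plus) = if (mkDyadic neg x le.length).neg then minus else plus
    := rfl
  set y := x / 2 ^ le.length with hy
  have hlen : y.bits.length ≤ x.bits.length := by
    rw [Nat.size_eq_bits_len, Nat.size_eq_bits_len]
    exact Nat.size_le_size (Nat.div_le_self _ _)
  simp only [List.length_map]
  refine .weaken (.seq (run_push _ _ _) (.seq h (.seq (run_move (by decide) _ _)
    (.seq (run_push _ _ _) (.seq (S₁ := Mem.store ⟨inp, qu, an,
      (intBits y).map bitSymb ++ point :: ((lowBits le.length x).reverse.map bitSymb ++ sep :: ou),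
        U, V, A, B, p, Q, [], H, [], T', ca, [if neg then minus else plus], le, fl⟩)
      (t₁ := 2 * x.bits.length + 3) ?_ ?_)))))
    (t := 1 + (4 * le.length + 1 + (2 * le.reverse.length + 1 + (1 +
      (2 * x.bits.length + 3 + (1 + 1)))))) (by simp; omega)
  · rcases eq_or_ne y 0 with h0 | h0
    · refine .weaken (run_pop (t := 1) ?_) (by omega)
      simp only [Mem.set, Mem.store, h0, Nat.zero_bits, List.map_nil]
      exact run_push_of_eq (by simp [Mem.set, Mem.store, intBits, bitSymb])
    · have hb := bits_eq_cons h0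
      have hlen' : (y / 2).bits.length + 1 = y.bits.length := by rw [hb]; rfl
      refine .weaken (run_pop (t := 1 + (2 * ((y / 2).bits.map bitSymb).length + 1)) ?_)
        (by simp; omega)
      simp only [Mem.set, Mem.store, hb, List.map_cons, List.head?_cons, List.tail_cons]
      refine .seq (run_push _ _ _) (run_move_of_eq (by decide) ?_)
      simp [Mem.set, Mem.store, intBits, h0, hb]
  · refine run_pop ?_
    refine run_push_of_eq ?_
    simp [Mem.set, Mem.store, DyadicString.encode, mkDyadic, ← hy]

/-! ### Reading a point -/

/-- The signed digit for a bit of a number with the given sign. -/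
def signedDigit (neg : Bool) (b : Bool) : Symb := if b then (if neg then minus else one) else zero

theorem digitsVal_signedDigit (neg : Bool) (l : List Bool) :
    digitsVal ((l.map (signedDigit neg)).reverse) = (if neg then -1 else 1) * natOfBits l := by
  have h : l.map (signedDigit neg) = (l.map bitSymb).map (if neg then flip else id) := by
    rw [List.map_map]
    refine List.map_congr_left fun b _ => ?_
    cases neg <;> cases b <;> rfl
  rw [h, ← List.map_reverse]
  cases neg
  · simp [digitsVal_bits]
  · simp only [if_true, List.map_reverse, neg_one_mul]
    rw [← List.map_reverse, digitsVal_map_flip, digitsVal_bits]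

/-- Push a digit of the current coordinate. -/
def storeDigit (s : Symb) : StackProg Reg :=
  pop (.inr .flag) fun o => match o with
    | none => push (.inr .U) s
    | some _ => push (.inr .flag) sep ;; push (.inr .V) s

/-- Process a symbol of the oracle's answer. -/
def readSymb : Symb → StackProg Reg
  | plus => push (.inr .sign) plus
  | minus => push (.inr .sign) minus
  | point => skip
  | sep => pop (.inr .sign) fun _ => push (.inr .flag) sep
  | zero => storeDigit zero
  | one => pop (.inr .sign) fun s => push (.inr .sign) (s.getD plus) ;;
      storeDigit (if s = some minus then minus else one)

/-- Read the oracle's answer onto the stacks `U` and `V`. -/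
def readPoint : StackProg Reg := loop (.inl .answer) readSymb

theorem run_readBit_fst (neg b : Bool) (m : Mem) (hs : m.sign = [if neg then minus else plus])
    (hf : m.flag = []) :
    Run O (readSymb (bitSymb b)) m 5 { m with U := signedDigit neg b :: m.U } := by
  obtain ⟨inp, qu, an, ou, U, V, A, B, p, Q, r, H, T, T', ca, sg, le, fl⟩ := m
  simp only at hs hf
  subst hs hf
  cases b
  · refine .weaken (run_pop (t := 1) ?_) (by omega)
    exact run_push_of_eq (by simp [Mem.set, Mem.store, signedDigit])
  · refine .weaken (run_pop (t := 1 + (1 + 1)) ?_) (by omega)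
    refine .seq (run_push _ _ _) (run_pop ?_)
    refine run_push_of_eq ?_
    cases neg <;> simp [Mem.set, Mem.store, signedDigit]

theorem run_readBit_snd (neg b : Bool) (m : Mem) (hs : m.sign = [if neg then minus else plus])
    (hf : m.flag = [sep]) :
    Run O (readSymb (bitSymb b)) m 5 { m with V := signedDigit neg b :: m.V } := by
  obtain ⟨inp, qu, an, ou, U, V, A, B, p, Q, r, H, T, T', ca, sg, le, fl⟩ := m
  simp only at hs hf
  subst hs hf
  cases b
  · refine .weaken (run_pop (t := 1 + 1) ?_) (by omega)
    refine .seq (run_push _ _ _) (run_push_of_eq ?_)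
    simp [Mem.set, Mem.store, signedDigit]
  · refine .weaken (run_pop (t := 1 + (1 + (1 + 1))) ?_) (by omega)
    refine .seq (run_push _ _ _) (run_pop ?_)
    refine .seq (run_push _ _ _) (run_push_of_eq ?_)
    cases neg <;> simp [Mem.set, Mem.store, signedDigit]

theorem run_readBits_fst (neg : Bool) (l : List Bool) (rest : List Symb) (m m' : Mem) (t : ℕ)
    (hs : m.sign = [if neg then minus else plus]) (hf : m.flag = [])
    (h : Run O readPoint { m with answer := rest, U := (l.map (signedDigit neg)).reverse ++ m.U }
      t m') :
    Run O readPoint { m with answer := l.map bitSymb ++ rest } (6 * l.length + t) m' := by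
  induction l generalizing m with
  | nil => simpa using h
  | cons b l ih =>
    have h1 := ih { m with U := signedDigit neg b :: m.U } hs hf (by simpa using h)
    simp only [List.length_cons]
    refine .weaken (run_loop_cons rfl (t₁ := 5) ?_ h1) (by omega)
    exact run_readBit_fst neg b _ hs hf

theorem run_readBits_snd (neg : Bool) (l : List Bool) (rest : List Symb) (m m' : Mem) (t : ℕ)
    (hs : m.sign = [if neg then minus else plus]) (hf : m.flag = [sep])
    (h : Run O readPoint { m with answer := rest, V := (l.map (signedDigit neg)).reverse ++ m.V }
      t m') :
    Run O readPoint { m with answer := l.map bitSymb ++ rest } (6 * l.length + t) m' := by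
  induction l generalizing m with
  | nil => simpa using h
  | cons b l ih =>
    have h1 := ih { m with V := signedDigit neg b :: m.V } hs hf (by simpa using h)
    simp only [List.length_cons]
    refine .weaken (run_loop_cons rfl (t₁ := 5) ?_ h1) (by omega)
    exact run_readBit_snd neg b _ hs hf

/-- The signed digits of a dyadic string, least significant digit first. -/
def digits (a : DyadicString) : List Symb :=
  ((a.int ++ a.frac).map (signedDigit a.neg)).reverse

theorem length_digits (a : DyadicString) : (digits a).length = a.int.length + a.prec := by
  simp [digits, DyadicString.prec, add_comm]

theorem digitsVal_digits (a : DyadicString) :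
    (digitsVal (digits a) : ℝ) = a.value * 2 ^ a.prec := by
  rw [digits, digitsVal_signedDigit, DyadicString.value, DyadicString.prec]
  cases a.neg <;> simp

theorem run_readPoint (q : Fin 2 → DyadicString) (m : Mem) (ha : m.answer = encodeTuple q)
    (hU : m.U = []) (hV : m.V = []) (hs : m.sign = []) (hf : m.flag = []) :
    Run O readPoint m (6 * (digits (q 0)).length + 6 * (digits (q 1)).length + 20)
      { m with answer := [], U := digits (q 0), V := digits (q 1), flag := [sep, sep] } := by
  obtain ⟨inp, qu, an, ou, U, V, A, B, p, Q, r, H, T, T', ca, sg, le, fl⟩ := m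
  simp only at ha hU hV hs hf
  subst ha hU hV hs hf
  have e : encodeTuple q = (if (q 0).neg then minus else plus) ::
      ((q 0).int.map bitSymb ++ point :: ((q 0).frac.map bitSymb ++ sep ::
      ((if (q 1).neg then minus else plus) ::
      ((q 1).int.map bitSymb ++ point :: ((q 1).frac.map bitSymb ++ [sep]))))) := by
    simp [encodeTuple, DyadicString.encode, List.ofFn_succ]
  rw [e]
  have hsign : ∀ (b : Bool) (m : Mem), m.sign = [] →
      Run O (readSymb (if b then minus else plus)) m 1
        { m with sign := [if b then minus else plus] } := by
    intro b m hm
    cases b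
    · exact run_push_of_eq (by simp [Mem.set, Mem.store, hm])
    · exact run_push_of_eq (by simp [Mem.set, Mem.store, hm])
  simp only [length_digits, DyadicString.prec]
  refine .weaken (t := 1 + 1 + (6 * (q 0).int.length + (1 + 1 + (6 * (q 0).frac.length +
    (1 + (1 + 1) + (1 + 1 + (6 * (q 1).int.length + (1 + 1 + (6 * (q 1).frac.length +
    (1 + (1 + 1) + 1)))))))))) ?_ (by omega)
  refine run_loop_cons rfl (hsign _ _ rfl) ?_
  refine run_readBits_fst (q 0).neg _ _ ⟨inp, qu, [], ou, [], [], A, B, p, Q, r, H, T, T', ca,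
    [if (q 0).neg then minus else plus], le, []⟩ _ _ rfl rfl ?_
  refine run_loop_cons rfl (.skip _) ?_
  refine run_readBits_fst (q 0).neg _ _ ⟨inp, qu, [], ou, _, [], A, B, p, Q, r, H, T, T', ca,
    [if (q 0).neg then minus else plus], le, []⟩ _ _ rfl rfl ?_
  refine run_loop_cons rfl (run_pop (run_push _ _ _)) ?_
  refine run_loop_cons rfl (hsign _ _ rfl) ?_
  refine run_readBits_snd (q 1).neg _ _ ⟨inp, qu, [], ou, _, [], A, B, p, Q, r, H, T, T', ca,
    [if (q 1).neg then minus else plus], le, [sep]⟩ _ _ rfl rfl ?_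
  refine run_loop_cons rfl (.skip _) ?_
  refine run_readBits_snd (q 1).neg _ _ ⟨inp, qu, [], ou, _, _, A, B, p, Q, r, H, T, T', ca,
    [if (q 1).neg then minus else plus], le, [sep]⟩ _ _ rfl rfl ?_
  refine run_loop_cons rfl (run_pop (run_push _ _ _)) ?_
  simp only [Mem.set, Mem.store, digits, List.map_append, List.reverse_append, List.append_nil,
    List.tail_cons]
  exact run_loop_nil rfl

/-! ### Rounding -/

/-- Round the quotient of the integer `z` by `2 ^ j` to an integer, and write it in units of
`2 ^ (-n)`. The number `h` is added to the absolute value before it is rounded down;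
`h = 2 ^ (j - 1)` gives the nearest integer. -/
def roundedString (z : ℤ) (h j n : ℕ) : DyadicString :=
  mkDyadic (decide (z < 0)) ((z.natAbs + h) / 2 ^ j) n

/-- Write the number on `R`, divided by `2 ^ j` and rounded, where `j` is the length of `H` and the
value of `H` is added to the absolute value before rounding down. -/
def emitRounded : StackProg Reg :=
  splitSign ;; copy (.inr .H) (.inr .P) ;; addScaled one ;; toBinary ;; dropDigits ;; emit

theorem run_emitRounded (h : ℕ) (m : Mem) (hT : m.T = []) (hT' : m.T' = []) (hc : m.carry = [])
    (hs : m.sign = []) (hP : m.P = []) (hH : digitsVal m.H = h) :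
    Run O emitRounded m (100 * (m.R.length + m.H.length + m.len.length + 1))
      { m with R := [], output := (roundedString (digitsVal m.R) h m.H.length m.len.length).encode ++
        sep :: m.output } := by
  obtain ⟨inp, qu, an, ou, U, V, A, B, p, Q, r, H, T, T', ca, sg, le, fl⟩ := m
  simp only at hT hT' hc hs hP hH
  subst hT hT' hc hs hP
  obtain ⟨r₁, h₁, hl₁, hv₁⟩ := run_splitSign (O := O)
    ⟨inp, qu, an, ou, U, V, A, B, [], Q, r, H, [], [], [], [], le, fl⟩ rfl rfl
  simp only at h₁ hl₁ hv₁
  set sg := if digitsVal r < 0 then minus else plus with hsg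
  obtain ⟨r₂, h₂, hl₂, hv₂⟩ := run_addScaled (O := O) one
    ⟨inp, qu, an, ou, U, V, A, B, H, Q, r₁, H, [], [], [], [sg], le, fl⟩ rfl rfl rfl
  simp only at h₂ hl₂ hv₂
  have hv : digitsVal r₂ = (((digitsVal r).natAbs + h : ℕ) : ℤ) := by
    rw [hv₂, hv₁, hH]
    simp [dig, add_comm]
  have h₃ := run_toBinary (O := O)
    ⟨inp, qu, an, ou, U, V, A, B, H, Q, r₂, H, [], [], [], [sg], le, fl⟩ rfl rfl
      (by simp only [hv]; positivity)
  simp only [hv, Int.toNat_natCast] at h₃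
  set x := (digitsVal r).natAbs + h with hx
  have h₄ := run_dropDigits (O := O) x H
    ⟨inp, qu, an, ou, U, V, A, B, [], Q, [], H, [], [], [], [sg], le, fl⟩
  simp only at h₄
  have h₅ := run_emit (O := O) (decide (digitsVal r < 0)) (x / 2 ^ H.length)
    ⟨inp, qu, an, ou, U, V, A, B, [], Q, (x / 2 ^ H.length).bits.map bitSymb, H, [], [], [], [sg],
      le, fl⟩ rfl (by simp [hsg]) rfl
  simp only at h₅
  have hlen : (x / 2 ^ H.length).bits.length ≤ r₂.length := by
    have h6 : x < 2 ^ r₂.length := by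
      have : digitsVal r₂ < 2 ^ r₂.length := by
        clear * -
        induction r₂ with
        | nil => simp
        | cons s l ih =>
          have := abs_dig_le s
          simp only [digitsVal_cons, List.length_cons, pow_succ]
          omega
      rw [hv] at this
      exact_mod_cast this
    rw [Nat.size_eq_bits_len]
    exact Nat.size_le.2 ((Nat.div_le_self _ _).trans_lt h6)
  refine .weaken (.seq h₁ (.seq (run_copy (a := .inr .H) (c := .inr .P)
    (by decide) (by decide) (by decide) id _ rfl) (.seq
    (S₁ := Mem.store ⟨inp, qu, an, ou, U, V, A, B, H, Q, r₂, H, [], [], [], [sg], le, fl⟩)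
    ?_ (.seq h₃ (.seq h₄ h₅)))))
      (t := 6 * r.length + 5 + (5 * H.length + 2 + (20 * (H.length + r₁.length + 1) +
        (8 * r₂.length + 5 + (3 * H.length + 1 + (6 * le.length +
          2 * ((x / 2 ^ H.length).bits.map bitSymb).length + 10)))))) ?_
  · simp only [Mem.set, Mem.store, List.map_id, List.append_nil]
    exact h₂
  · simp only [List.length_map]
    omega

/-! ### Sums of products -/

namespace Mem

theorem store_set_of_ne (m : Mem) {j k : Port ⊕ Reg} (h : j ≠ k) (l : List Symb) :
    (m.set k l).store j = m.store j := by
  rw [← update_store, Function.update_of_ne h]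

end Mem

/-- Add the product of two stacks, the first of them transformed by `f`, to `R`. -/
def addProduct (a b : Port ⊕ Reg) (f : Symb → Symb := id) : StackProg Reg :=
  copy a (.inr .P) f ;; copy b (.inr .Q) ;; addMul

theorem run_addProduct {a b : Port ⊕ Reg} (f : Symb → Symb) (m : Mem)
    (ha : a ≠ .inr .T ∧ a ≠ .inr .P) (hb : b ≠ .inr .T ∧ b ≠ .inr .P ∧ b ≠ .inr .Q)
    (hT : m.T = []) (hT' : m.T' = []) (hc : m.carry = []) (hP : m.P = []) (hQ : m.Q = []) :
    ∃ r : List Symb, Run O (addProduct a b f) m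
        (110 * ((m.store a).length + 2 * (m.store b).length + m.R.length + 1) ^ 2)
        { m with R := r } ∧
      r.length ≤ (m.store a).length + 2 * (m.store b).length + m.R.length ∧
      digitsVal r = digitsVal m.R + digitsVal ((m.store a).map f) * digitsVal (m.store b) := by
  have h₁ := run_copy (O := O) (a := a) (c := .inr .P) ha.2 ha.1 (by decide) f m hT
  have h₂ := run_copy (O := O) (a := b) (c := .inr .Q) hb.2.2 hb.1 (by decide) id
    (m.set (.inr .P) ((m.store a).map f ++ m.store (.inr .P))) hT
  rw [store_set_of_ne m hb.2.1] at h₂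
  generalize m.store a = x at *
  generalize m.store b = y at *
  obtain ⟨inp, qu, an, ou, U, V, A, B, p, Q, r, H, T, T', ca, sg, le, fl⟩ := m
  simp only at hT hT' hc hP hQ
  subst hT hT' hc hP hQ
  obtain ⟨r', h₃, hl, hv⟩ := run_addMul (O := O) ⟨inp, qu, an, ou, U, V, A, B, x.map f, y, r, H,
    [], [], [], sg, le, fl⟩ rfl rfl rfl
  simp only [List.length_map] at h₃ hl hv ⊢
  refine ⟨r', ?_, hl, hv⟩
  refine .weaken (.seq h₁ (.seq h₂ ?_))
    (t := 5 * x.length + 2 + (5 * y.length + 2 + 100 * (x.length + 2 * y.length + r.length + 1) ^ 2))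
    ?_
  · simp only [Mem.set, Mem.store, List.map_id, List.append_nil]
    exact h₃
  · nlinarith

/-! ### The evaluation program -/

/-- Push a list of symbols. -/
def pushAll (k : Port ⊕ Reg) : List Symb → StackProg Reg
  | [] => skip
  | s :: l => pushAll k l ;; push k s

theorem run_pushAll (k : Port ⊕ Reg) (l : List Symb) (m : Mem) :
    Run O (pushAll k l) m (l.length + 1) (m.set k (l ++ m.store k)) := by
  induction l with
  | nil =>
    have h : m.set k ([] ++ m.store k) = m := by
      rcases k with (_ | _ | _ | _) |
        (_ | _ | _ | _ | _ | _ | _ | _ | _ | _ | _ | _ | _ | _) <;> rfl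
    rw [h]
    exact .skip _
  | cons s l ih =>
    refine .seq ih ?_
    refine run_push_of_eq ?_
    rcases k with (_ | _ | _ | _) |
        (_ | _ | _ | _ | _ | _ | _ | _ | _ | _ | _ | _ | _ | _) <;> rfl

/-- Scale the initial data according to the precision. -/
def prepare : StackProg Reg :=
  loop (.inl .input) fun _ => push (.inl .query) zero ;; push (.inr .len) zero ;;
    push (.inr .A) zero ;; push (.inr .A) zero ;; push (.inr .B) zero ;; push (.inr .B) zero ;;
    push (.inr .H) zero ;; push (.inr .H) zero

theorem replicate_append_cons (n : ℕ) (s : Symb) (l : List Symb) :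
    List.replicate n s ++ s :: l = s :: (List.replicate n s ++ l) := by
  rw [← List.singleton_append, ← List.append_assoc, ← List.replicate_succ', List.replicate_succ,
    List.cons_append]

theorem run_prepare (n : ℕ) (q le a b h : List Symb) (m : Mem) :
    Run O prepare { m with input := unary n, query := q, len := le, A := a, B := b, H := h }
      (9 * n + 1)
      { m with input := [], query := unary n ++ q, len := unary n ++ le, A := unary (2 * n) ++ a,
               B := unary (2 * n) ++ b, H := unary (2 * n) ++ h } := by
  induction n generalizing q le a b h with
  | zero => exact run_loop_nil rfl
  | succ n ih =>
    have h' := ih (zero :: q) (zero :: le) (zero :: zero :: a) (zero :: zero :: b)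
      (zero :: zero :: h)
    refine .weaken (t := 1 + (1 + (1 + (1 + (1 + (1 + (1 + (1 + 1))))))) + (9 * n + 1)) ?_ (by omega)
    have e : 2 * (n + 1) = 2 * n + 1 + 1 := by ring
    simp only [unary, e, List.replicate_succ, replicate_append_cons, List.cons_append] at h' ⊢
    refine run_loop_cons rfl ?_ h'
    refine .seq (run_push _ _ _) ?_
    refine .seq (run_push _ _ _) ?_
    refine .seq (run_push _ _ _) ?_
    refine .seq (run_push _ _ _) ?_
    refine .seq (run_push _ _ _) ?_
    refine .seq (run_push _ _ _) ?_
    refine .seq (run_push _ _ _) ?_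
    exact run_push_of_eq (by simp only [Mem.set, Mem.store])

/-- Set up the factors `A`, `B` and the summand `H`, and query the point with four additional
bits. -/
def setup (a b h : List Symb) : StackProg Reg :=
  pushAll (.inr .A) a ;; pushAll (.inr .B) b ;; pushAll (.inr .H) h ;;
    pushAll (.inl .query) (unary 4) ;; prepare ;; ask ;; readPoint

/-- The memory containing an input and nothing else. -/
def inputMem (w : List Symb) : Mem :=
  ⟨w, [], [], [], [], [], [], [], [], [], [], [], [], [], [], [], [], []⟩

theorem run_setup (φ : ℕ → Fin 2 → DyadicString) (a b h : List Symb) (n : ℕ) :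
    Run (nameOracle φ) (setup a b h) (inputMem (unary n)) (9 * n + a.length + b.length + h.length +
        6 * (digits (φ (n + 4) 0)).length + 6 * (digits (φ (n + 4) 1)).length + 40)
      { inputMem [] with
        A := unary (2 * n) ++ a
        B := unary (2 * n) ++ b
        H := unary (2 * n) ++ h
        len := unary n
        U := digits (φ (n + 4) 0)
        V := digits (φ (n + 4) 1)
        flag := [sep, sep] } := by
  have h₁ := run_prepare (O := nameOracle φ) n (unary 4) [] a b h (inputMem [])
  have h₂ := run_readPoint (O := nameOracle φ) (φ (n + 4)) { inputMem [] with
        answer := encodeTuple (φ (n + 4))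
        A := unary (2 * n) ++ a
        B := unary (2 * n) ++ b
        H := unary (2 * n) ++ h
        len := unary n } rfl rfl rfl rfl rfl
  refine .weaken (.seq (run_pushAll _ _ _) (.seq (run_pushAll _ _ _) (.seq (run_pushAll _ _ _)
    (.seq (run_pushAll _ _ _) (.seq (S₁ := Mem.store { inputMem [] with
        query := unary n ++ unary 4
        A := unary (2 * n) ++ a
        B := unary (2 * n) ++ b
        H := unary (2 * n) ++ h
        len := unary n }) ?_ (.seq (run_ask _) ?_))))))
    (t := a.length + 1 + (b.length + 1 + (h.length + 1 + ((unary 4).length + 1 + (9 * n + 1 +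
      (1 + (6 * (digits (φ (n + 4) 0)).length + 6 * (digits (φ (n + 4) 1)).length + 20)))))))
    (by simp [unary]; omega)
  · simp only [List.append_nil, inputMem] at h₁
    simp only [Mem.set, Mem.store, inputMem, List.append_nil]
    exact h₁
  · have e : unary n ++ unary 4 = unary (n + 4) := List.replicate_append_replicate
    have e' : nameOracle φ (unary n ++ unary 4) = encodeTuple (φ (n + 4)) := by
      rw [e, nameOracle]
      simp [unary]
    simp only [e']
    exact h₂

/-- Move the contents of a stack to an empty stack. -/
def transfer (a b : Port ⊕ Reg) : StackProg Reg := move a (.inr .T) ;; move (.inr .T) b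

theorem run_transfer {a b : Port ⊕ Reg} (m : Mem) (hab : a ≠ b) (ha : a ≠ .inr .T)
    (hb : b ≠ .inr .T) (hT : m.T = []) (hbm : m.store b = []) :
    Run O (transfer a b) m (4 * (m.store a).length + 2) ((m.set a []).set b (m.store a)) := by
  have hT' : m.store (.inr .T) = [] := hT
  have h1 := exec_loop_push (O := O) ha id _ m.store rfl
  have h2 := exec_loop_push (O := O) hb.symm id (m.store a).reverse
    (Function.update (Function.update m.store a []) (.inr .T)
      (((m.store a).map id).reverse ++ m.store (.inr .T))) (by simp [hT'])
  unfold Run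
  rw [← update_store, ← update_store]
  refine .weaken (.seq h1 ?_) (t := 2 * (m.store a).length + 1 + (2 * (m.store a).length + 1))
    (by omega)
  convert h2 using 1
  · rfl
  · simp
  funext j
  simp only [Function.update_apply]
  split_ifs <;> simp_all

/-- Subtract the squares of `U` and `V` from `A`, and add the result to `B`. -/
def perturb : StackProg Reg :=
  transfer (.inr .A) (.inr .R) ;;
  addProduct (.inr .U) (.inr .U) flip ;; addProduct (.inr .V) (.inr .V) flip ;;
  transfer (.inr .R) (.inr .A) ;; transfer (.inr .B) (.inr .R) ;;
  copy (.inr .A) (.inr .P) ;; push (.inr .Q) one ;; addMul ;; transfer (.inr .R) (.inr .B)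

theorem run_perturb (m : Mem) (X : ℕ) (hT : m.T = []) (hT' : m.T' = []) (hc : m.carry = [])
    (hP : m.P = []) (hQ : m.Q = []) (hR : m.R = [])
    (hX : m.A.length + m.B.length + m.U.length + m.V.length + 1 ≤ X) :
    ∃ a b : List Symb, Run O perturb m (100000 * X ^ 2) { m with A := a, B := b } ∧
      a.length ≤ 10 * X ∧ b.length ≤ 10 * X ∧
      digitsVal a = digitsVal m.A - digitsVal m.U ^ 2 - digitsVal m.V ^ 2 ∧
      digitsVal b = digitsVal m.B + digitsVal a := by
  obtain ⟨inp, qu, an, ou, U, V, A, B, p, Q, r, H, T, T', ca, sg, le, fl⟩ := m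
  simp only at hT hT' hc hP hQ hR hX
  subst hT hT' hc hP hQ hR
  have h₀ := run_transfer (O := O) (a := .inr .A) (b := .inr .R)
    ⟨inp, qu, an, ou, U, V, A, B, [], [], [], H, [], [], [], sg, le, fl⟩
    (by decide) (by decide) (by decide) rfl rfl
  obtain ⟨r₁, h₁, hl₁, hv₁⟩ := run_addProduct (O := O) (a := .inr .U) (b := .inr .U) flip
    ⟨inp, qu, an, ou, U, V, [], B, [], [], A, H, [], [], [], sg, le, fl⟩
    (by decide) (by decide) rfl rfl rfl rfl rfl
  obtain ⟨r₂, h₂, hl₂, hv₂⟩ := run_addProduct (O := O) (a := .inr .V) (b := .inr .V) flip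
    ⟨inp, qu, an, ou, U, V, [], B, [], [], r₁, H, [], [], [], sg, le, fl⟩
    (by decide) (by decide) rfl rfl rfl rfl rfl
  have h₃ := run_transfer (O := O) (a := .inr .R) (b := .inr .A)
    ⟨inp, qu, an, ou, U, V, [], B, [], [], r₂, H, [], [], [], sg, le, fl⟩
    (by decide) (by decide) (by decide) rfl rfl
  have h₄ := run_transfer (O := O) (a := .inr .B) (b := .inr .R)
    ⟨inp, qu, an, ou, U, V, r₂, B, [], [], [], H, [], [], [], sg, le, fl⟩
    (by decide) (by decide) (by decide) rfl rfl
  have h₅ := run_copy (O := O) (a := .inr .A) (c := .inr .P) (by decide) (by decide) (by decide) id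
    ⟨inp, qu, an, ou, U, V, r₂, [], [], [], B, H, [], [], [], sg, le, fl⟩ rfl
  obtain ⟨r₃, h₆, hl₃, hv₃⟩ := run_addMul (O := O)
    ⟨inp, qu, an, ou, U, V, r₂, [], r₂, [one], B, H, [], [], [], sg, le, fl⟩ rfl rfl rfl
  have h₇ := run_transfer (O := O) (a := .inr .R) (b := .inr .B)
    ⟨inp, qu, an, ou, U, V, r₂, [], [], [], r₃, H, [], [], [], sg, le, fl⟩
    (by decide) (by decide) (by decide) rfl rfl
  simp only [Mem.set, Mem.store, List.map_id, List.append_nil, digitsVal_map_flip] at *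
  simp only [List.length_singleton] at hl₃ h₆
  refine ⟨r₂, r₃, ?_, by omega, by omega, by rw [hv₂, hv₁]; ring, by rw [hv₃]; simp [dig]⟩
  refine .weaken (.seq h₀ (.seq h₁ (.seq h₂ (.seq h₃ (.seq h₄ (.seq h₅ (.seq
    (run_push_of_eq (by simp only [Mem.set, Mem.store])) (.seq h₆ h₇)))))))) ?_
  have b1 : (U.length + 2 * U.length + A.length + 1) ^ 2 ≤ (4 * X) ^ 2 :=
    Nat.pow_le_pow_left (by omega) 2
  have b2 : (V.length + 2 * V.length + r₁.length + 1) ^ 2 ≤ (10 * X) ^ 2 :=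
    Nat.pow_le_pow_left (by omega) 2
  have b3 : (r₂.length + 2 * 1 + B.length + 1) ^ 2 ≤ (15 * X) ^ 2 :=
    Nat.pow_le_pow_left (by omega) 2
  have b4 : X ≤ X ^ 2 := Nat.le_self_pow (by norm_num) X
  rw [mul_pow] at b1 b2 b3
  omega

/-- Write the values of `A U - B V` and `B U + A V`. (The output is a stack, so that the second
coordinate is written before the first one.) -/
def finish : StackProg Reg :=
  addProduct (.inr .B) (.inr .U) ;; addProduct (.inr .A) (.inr .V) ;; emitRounded ;;
  addProduct (.inr .A) (.inr .U) ;; addProduct (.inr .B) (.inr .V) flip ;; emitRounded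

theorem run_finish (m : Mem) (h X : ℕ) (hT : m.T = []) (hT' : m.T' = []) (hc : m.carry = [])
    (hP : m.P = []) (hQ : m.Q = []) (hR : m.R = []) (hs : m.sign = []) (ho : m.output = [])
    (hH : digitsVal m.H = h)
    (hX : m.A.length + m.B.length + m.U.length + m.V.length + m.H.length + m.len.length + 1 ≤ X) :
    Run O finish m (100000 * X ^ 2) { m with output := (encodeTuple
      ![roundedString (digitsVal m.A * digitsVal m.U - digitsVal m.B * digitsVal m.V) h m.H.length
          m.len.length,
        roundedString (digitsVal m.B * digitsVal m.U + digitsVal m.A * digitsVal m.V) h m.H.length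
          m.len.length]) } := by
  obtain ⟨inp, qu, an, ou, U, V, A, B, p, Q, r, H, T, T', ca, sg, le, fl⟩ := m
  simp only at hT hT' hc hP hQ hR hX hs ho hH
  subst hT hT' hc hP hQ hR hs ho
  obtain ⟨r₁, h₁, hl₁, hv₁⟩ := run_addProduct (O := O) (a := .inr .B) (b := .inr .U) id
    ⟨inp, qu, an, [], U, V, A, B, [], [], [], H, [], [], [], [], le, fl⟩
    (by decide) (by decide) rfl rfl rfl rfl rfl
  obtain ⟨r₂, h₂, hl₂, hv₂⟩ := run_addProduct (O := O) (a := .inr .A) (b := .inr .V) id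
    ⟨inp, qu, an, [], U, V, A, B, [], [], r₁, H, [], [], [], [], le, fl⟩
    (by decide) (by decide) rfl rfl rfl rfl rfl
  have h₃ := run_emitRounded (O := O) h
    ⟨inp, qu, an, [], U, V, A, B, [], [], r₂, H, [], [], [], [], le, fl⟩ rfl rfl rfl rfl rfl hH
  simp only [Mem.store, List.map_id, digitsVal_nil, zero_add, List.length_nil]
    at h₁ hl₁ hv₁ h₂ hl₂ hv₂ h₃
  rw [hv₂, hv₁] at h₃
  set o := (roundedString (digitsVal B * digitsVal U + digitsVal A * digitsVal V) h H.length
    le.length).encode ++ [sep] with ho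
  obtain ⟨r₄, h₄, hl₄, hv₄⟩ := run_addProduct (O := O) (a := .inr .A) (b := .inr .U) id
    ⟨inp, qu, an, o, U, V, A, B, [], [], [], H, [], [], [], [], le, fl⟩
    (by decide) (by decide) rfl rfl rfl rfl rfl
  obtain ⟨r₅, h₅, hl₅, hv₅⟩ := run_addProduct (O := O) (a := .inr .B) (b := .inr .V) flip
    ⟨inp, qu, an, o, U, V, A, B, [], [], r₄, H, [], [], [], [], le, fl⟩
    (by decide) (by decide) rfl rfl rfl rfl rfl
  have h₆ := run_emitRounded (O := O) h
    ⟨inp, qu, an, o, U, V, A, B, [], [], r₅, H, [], [], [], [], le, fl⟩ rfl rfl rfl rfl rfl hH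
  simp only [Mem.store, List.map_id, digitsVal_nil, zero_add, List.length_nil,
    digitsVal_map_flip, neg_mul] at h₄ hl₄ hv₄ h₅ hl₅ hv₅ h₆
  rw [hv₅, hv₄, ← sub_eq_add_neg] at h₆
  have e : encodeTuple ![roundedString (digitsVal A * digitsVal U - digitsVal B * digitsVal V) h
      H.length le.length, roundedString (digitsVal B * digitsVal U + digitsVal A * digitsVal V) h
      H.length le.length] = (roundedString (digitsVal A * digitsVal U -
      digitsVal B * digitsVal V) h H.length le.length).encode ++ sep :: o := by
    simp [encodeTuple, List.ofFn_succ, ho]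
  simp only
  rw [e]
  refine .weaken (.seq h₁ (.seq h₂ (.seq h₃ (.seq h₄ (.seq h₅ h₆))))) ?_
  have b1 : (B.length + 2 * U.length + 0 + 1) ^ 2 ≤ (3 * X) ^ 2 :=
    Nat.pow_le_pow_left (by omega) 2
  have b2 : (A.length + 2 * V.length + r₁.length + 1) ^ 2 ≤ (6 * X) ^ 2 :=
    Nat.pow_le_pow_left (by omega) 2
  have b3 : (A.length + 2 * U.length + 0 + 1) ^ 2 ≤ (3 * X) ^ 2 :=
    Nat.pow_le_pow_left (by omega) 2
  have b4 : (B.length + 2 * V.length + r₄.length + 1) ^ 2 ≤ (6 * X) ^ 2 :=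
    Nat.pow_le_pow_left (by omega) 2
  have b5 : X ≤ X ^ 2 := Nat.le_self_pow (by norm_num) X
  rw [mul_pow] at b1 b2 b3 b4
  omega

/-- Execute one of two programs, depending on whether the input has at most `N` symbols. -/
def branchLe : ℕ → StackProg Reg → StackProg Reg → StackProg Reg
  | 0, c, d => pop (.inl .input) fun o => match o with
    | none => c
    | some s => push (.inl .input) s ;; d
  | N + 1, c, d => pop (.inl .input) fun o => match o with
    | none => c
    | some s => branchLe N (push (.inl .input) s ;; c) (push (.inl .input) s ;; d)

theorem run_branchLe (N : ℕ) (c d : StackProg Reg) (w : List Symb) (m m' : Mem) (t : ℕ)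
    (h : Run O (if w.length ≤ N then c else d) { m with input := w } t m') :
    Run O (branchLe N c d) { m with input := w } (2 * N + 2 + t) m' := by
  induction N generalizing c d w t with
  | zero =>
    rcases w with _ | ⟨s, w⟩
    · exact .weaken (run_pop h) (by omega)
    · simp only [List.length_cons, Nat.le_zero, Nat.add_eq_zero_iff, one_ne_zero, and_false,
        if_false] at h
      exact .weaken (run_pop (t := 1 + t) (.seq (run_push_of_eq (by
        simp only [Mem.set, Mem.store]; rfl)) h)) (by omega)
  | succ N ih =>
    rcases w with _ | ⟨s, w⟩
    · simp only [List.length_nil, Nat.zero_le, if_true] at h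
      exact .weaken (run_pop h) (by omega)
    · refine .weaken (run_pop (t := 2 * N + 2 + (1 + t)) ?_) (by omega)
      refine ih (push (.inl .input) s ;; c) (push (.inl .input) s ;; d) w (1 + t) ?_
      simp only [List.length_cons, Nat.add_le_add_iff_right] at h
      split_ifs at h ⊢
      · exact .seq (run_push_of_eq (by simp only [Mem.set, Mem.store])) h
      · exact .seq (run_push_of_eq (by simp only [Mem.set, Mem.store])) h

theorem run_branchLe_of_le {N : ℕ} {c d : StackProg Reg} {w : List Symb} {m m' : Mem} {t : ℕ}
    (hw : w.length ≤ N) (h : Run O c { m with input := w } t m') :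
    Run O (branchLe N c d) { m with input := w } (2 * N + 2 + t) m' :=
  run_branchLe N c d w m m' t (by rwa [if_pos hw])

theorem run_branchLe_of_lt {N : ℕ} {c d : StackProg Reg} {w : List Symb} {m m' : Mem} {t : ℕ}
    (hw : N < w.length) (h : Run O d { m with input := w } t m') :
    Run O (branchLe N c d) { m with input := w } (2 * N + 2 + t) m' :=
  run_branchLe N c d w m m' t (by rwa [if_neg hw.not_ge])

/-- The program which evaluates the vector field for the parameter with the digits `c`: for
precision `n ≤ N` only its linear part is evaluated.

The coordinates of the point are stored in units of `2 ^ (-(n + 4))`. The factor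
`δ (c - |z|²)`, where `δ = 2 ^ (-(N + 6))`, is stored on `A` in units of `2 ^ (-(2 n + N + 14))`,
and `B` starts with the value `1` in these units. So the coordinates of the result appear in units
of `2 ^ (-(3 n + N + 18))`, and `2 n + N + 18` digits have to be removed for precision `n`; the
value of `H` is half a unit of the output. -/
def evalProg (N : ℕ) (c : List Symb) : StackProg Reg :=
  branchLe N
    (setup [] (unary (N + 14) ++ [one]) (unary (N + 17) ++ [one]) ;; finish)
    (setup (unary 8 ++ c) (unary (N + 14) ++ [one]) (unary (N + 17) ++ [one]) ;; perturb ;; finish)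

/-- The final value of the factor `A` in `evalProg`, for the point `(u, v)` in units of
`2 ^ (-(n + 4))`. -/
def factor (N : ℕ) (c : ℤ) (n : ℕ) (u v : ℤ) : ℤ :=
  if n ≤ N then 0 else c * 2 ^ (2 * n + 8) - u ^ 2 - v ^ 2

/-- The output of the evaluation program for the point which has the coordinates `u`, `v` in units
of `2 ^ (-(n + 4))`. -/
def evalOut (N : ℕ) (c : ℤ) (n : ℕ) (u v : ℤ) : Fin 2 → DyadicString :=
  ![roundedString (factor N c n u v * u - (2 ^ (2 * n + N + 14) + factor N c n u v) * v)
      (2 ^ (2 * n + N + 17)) (2 * n + N + 18) n,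
    roundedString ((2 ^ (2 * n + N + 14) + factor N c n u v) * u + factor N c n u v * v)
      (2 ^ (2 * n + N + 17)) (2 * n + N + 18) n]

theorem digitsVal_unary_append (n : ℕ) (l : List Symb) :
    digitsVal (unary n ++ l) = 2 ^ n * digitsVal l := by
  simp [digitsVal_append, unary]

@[simp] theorem length_unary (n : ℕ) : (unary n).length = n := by simp [unary]

theorem outputsWithin_evalProg (N : ℕ) (c : List Symb) (φ : ℕ → Fin 2 → DyadicString) (n X : ℕ)
    (hX : 10 * n + 4 * N + c.length + (digits (φ (n + 4) 0)).length +
      (digits (φ (n + 4) 1)).length + 100 ≤ X) :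
    (machine (evalProg N c)).OutputsWithin (nameOracle φ) (unary n) (100000000 * X ^ 2)
      (encodeTuple (evalOut N (digitsVal c) n (digitsVal (digits (φ (n + 4) 0)))
        (digitsVal (digits (φ (n + 4) 1))))) := by
  set U := digits (φ (n + 4) 0) with hU
  set V := digits (φ (n + 4) 1) with hV
  have hXX : X ≤ X ^ 2 := Nat.le_self_pow (by norm_num) X
  have hone : digitsVal [one] = 1 := by simp [dig]
  have key : ∃ m, Run (nameOracle φ) (evalProg N c) (inputMem (unary n)) (100000000 * X ^ 2 - 1) m ∧
      m.output = encodeTuple (evalOut N (digitsVal c) n (digitsVal U) (digitsVal V)) := by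
    have hH : digitsVal (unary (2 * n) ++ (unary (N + 17) ++ [one])) =
        ((2 ^ (2 * n + N + 17) : ℕ) : ℤ) := by
      rw [digitsVal_unary_append, digitsVal_unary_append, hone]
      push_cast
      ring
    have hB : digitsVal (unary (2 * n) ++ (unary (N + 14) ++ [one])) = 2 ^ (2 * n + N + 14) := by
      rw [digitsVal_unary_append, digitsVal_unary_append, hone]
      ring
    have hHl : (unary (2 * n) ++ (unary (N + 17) ++ [one])).length = 2 * n + N + 18 := by
      simp; omega
    by_cases hn : n ≤ N
    · have h₁ := run_setup φ [] (unary (N + 14) ++ [one]) (unary (N + 17) ++ [one]) n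
      have h₂ := run_finish (O := nameOracle φ) (2 ^ (2 * n + N + 17)) X rfl rfl rfl rfl rfl rfl
        rfl rfl hH (m := { inputMem [] with
          A := unary (2 * n) ++ []
          B := unary (2 * n) ++ (unary (N + 14) ++ [one])
          H := unary (2 * n) ++ (unary (N + 17) ++ [one])
          len := unary n, U := U, V := V, flag := [sep, sep] }) (by simp; omega)
      refine ⟨_, .weaken (run_branchLe_of_le (m := inputMem []) (by simpa using hn)
        (.seq (.weaken h₁ (t' := 1000 * X) (by simp [← hU, ← hV]; omega)) h₂)) (by omega), ?_⟩
      · have hA : digitsVal (unary (2 * n) ++ []) = 0 := by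
          rw [digitsVal_unary_append, digitsVal_nil, mul_zero]
        simp only [hA, hB, hHl, length_unary, evalOut, factor, hn, if_true, add_zero]
    · have h₁ := run_setup φ (unary 8 ++ c) (unary (N + 14) ++ [one]) (unary (N + 17) ++ [one]) n
      obtain ⟨a, b, h₂, hla, hlb, hva, hvb⟩ := run_perturb (O := nameOracle φ) { inputMem [] with
          A := unary (2 * n) ++ (unary 8 ++ c)
          B := unary (2 * n) ++ (unary (N + 14) ++ [one])
          H := unary (2 * n) ++ (unary (N + 17) ++ [one])
          len := unary n, U := U, V := V, flag := [sep, sep] } X rfl rfl rfl rfl rfl rfl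
          (by simp; omega)
      have h₃ := run_finish (O := nameOracle φ) (2 ^ (2 * n + N + 17)) (22 * X) rfl rfl rfl rfl
        rfl rfl rfl rfl hH (m := { inputMem [] with
          A := a
          B := b
          H := unary (2 * n) ++ (unary (N + 17) ++ [one])
          len := unary n, U := U, V := V, flag := [sep, sep] }) (by simp; omega)
      refine ⟨_, .weaken (run_branchLe_of_lt (m := inputMem []) (by simpa using hn)
        (.seq (.weaken h₁ (t' := 1000 * X) (by simp [← hU, ← hV]; omega)) (.seq h₂ h₃)))
        (by rw [mul_pow]; omega), ?_⟩
      · have hva' : digitsVal a = factor N (digitsVal c) n (digitsVal U) (digitsVal V) := by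
          rw [hva, factor, if_neg hn]
          simp only [digitsVal_unary_append]
          ring
        have hvb' : digitsVal b = 2 ^ (2 * n + N + 14) +
            factor N (digitsVal c) n (digitsVal U) (digitsVal V) := by
          rw [hvb, hva']
          simp only [digitsVal_unary_append, hone]
          ring
        simp only [hva', hvb', hHl, length_unary, evalOut]
  obtain ⟨m, h, ho⟩ := key
  have e : (inputMem (unary n)).store = Function.update (fun _ => []) (.inl .input) (unary n) := by
    funext j
    rcases j with (_ | _ | _ | _) |
      (_ | _ | _ | _ | _ | _ | _ | _ | _ | _ | _ | _ | _ | _) <;> rfl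
  unfold Run at h
  rw [e] at h
  have h' := h.outputsWithin
  have e2 : m.store (.inl .output) = m.output := rfl
  rw [e2, ho] at h'
  exact h'.mono (by omega)

/-! ### The vector fields and their computation -/

/-- The vector field `z ↦ i z + δ (c - |z|²) (1 + i) z` of the plane. -/
noncomputable def spiralField (δ c : ℝ) (x : Plane) : Plane :=
  !₂[δ * (c - x 0 ^ 2 - x 1 ^ 2) * x 0 - (1 + δ * (c - x 0 ^ 2 - x 1 ^ 2)) * x 1,
    (1 + δ * (c - x 0 ^ 2 - x 1 ^ 2)) * x 0 + δ * (c - x 0 ^ 2 - x 1 ^ 2) * x 1]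

/-- The size of the nonlinear part of a field which can be distinguished from a rotation only with
precision higher than `N`. -/
noncomputable def scale (N : ℕ) : ℝ := 1 / 2 ^ (N + 6)

theorem scale_pos (N : ℕ) : 0 < scale N := by unfold scale; positivity

theorem scale_le (N : ℕ) : scale N ≤ 1 / 64 := by
  unfold scale
  have : (1 : ℝ) ≤ 2 ^ N := one_le_pow₀ (by norm_num)
  rw [pow_add]
  apply one_div_le_one_div_of_le <;> linarith

theorem mem_annulus_iff {x : Plane} :
    x ∈ annulus ↔ 1 ≤ x 0 ^ 2 + x 1 ^ 2 ∧ x 0 ^ 2 + x 1 ^ 2 ≤ 4 := by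
  have h : ‖x‖ ^ 2 = x 0 ^ 2 + x 1 ^ 2 := by
    rw [EuclideanSpace.norm_sq_eq, Fin.sum_univ_two]
    simp
  unfold annulus
  rw [Set.mem_ofPred_eq, ← h]
  constructor
  · rintro ⟨h1, h2⟩
    constructor <;> nlinarith [norm_nonneg x]
  · rintro ⟨h1, h2⟩
    constructor <;> nlinarith [norm_nonneg x]

theorem abs_value_roundedString_sub_le (z : ℤ) (j n : ℕ) :
    |(roundedString z (2 ^ j) (j + 1) n).value - z / 2 ^ (j + 1 + n)| ≤ (1 / 2) ^ n / 2 := by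
  rw [roundedString, value_mkDyadic]
  have h1 := Nat.div_add_mod (z.natAbs + 2 ^ j) (2 ^ (j + 1))
  have h2 := Nat.mod_lt (z.natAbs + 2 ^ j) (show 0 < 2 ^ (j + 1) by positivity)
  set x := (z.natAbs + 2 ^ j) / 2 ^ (j + 1)
  set r := (z.natAbs + 2 ^ j) % 2 ^ (j + 1)
  have hp : (0 : ℝ) < 2 ^ j := by positivity
  have hn : (0 : ℝ) < 2 ^ n := by positivity
  have h3 : (2 * 2 ^ j * x + r : ℝ) = |(z : ℝ)| + 2 ^ j := by
    rw [← Int.cast_abs, Int.abs_eq_natAbs, ← pow_succ']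
    exact_mod_cast h1
  have h4 : (r : ℝ) < 2 * 2 ^ j := by
    rw [← pow_succ']
    exact_mod_cast h2
  have h5 : (0 : ℝ) ≤ r := by positivity
  have h6 : |(x : ℝ) - |(z : ℝ)| / (2 * 2 ^ j)| ≤ 1 / 2 := by
    have h7 : (x : ℝ) - |(z : ℝ)| / (2 * 2 ^ j) = (2 ^ j - r) / (2 * 2 ^ j) := by
      field_simp
      linarith
    rw [h7, abs_div, abs_of_pos (by positivity : (0 : ℝ) < 2 * 2 ^ j), div_le_iff₀ (by positivity),
      abs_le]
    constructor <;> linarith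
  have h8 : (if decide (z < 0) = true then -1 else 1) * (x : ℝ) / 2 ^ n - z / 2 ^ (j + 1 + n) =
      (if z < 0 then -1 else 1) * ((x : ℝ) - |(z : ℝ)| / (2 * 2 ^ j)) * (1 / 2) ^ n := by
    rw [pow_add, pow_succ', one_div_pow]
    by_cases hz : z < 0
    · rw [abs_of_neg (by exact_mod_cast hz)]
      simp only [hz, decide_true, if_true]
      field_simp
      ring
    · rw [abs_of_nonneg (by exact_mod_cast not_lt.1 hz)]
      simp only [hz, decide_false, if_false, Bool.false_eq_true]
      field_simp
  rw [h8, abs_mul, abs_mul, abs_of_pos (by positivity : (0 : ℝ) < (1 / 2) ^ n)]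
  have h9 : |(if z < 0 then -1 else 1 : ℝ)| = 1 := by split_ifs <;> simp
  rw [h9]
  nlinarith [show (0 : ℝ) < (1 / 2) ^ n by positivity]

/-- Effect of an error in the point and in the nonlinear factor on a coordinate of the field. -/
theorem abs_coord_sub_le {w w' p q a b η e : ℝ} (hw : |w' - w| * 3 + |w| * e ≤ η)
    (hp : |a - p| ≤ e) (hq : |b - q| ≤ e) (ha : |a| ≤ 3) (hb : |b| ≤ 3) :
    |w' * a - (1 + w') * b - (w * p - (1 + w) * q)| ≤ e + 2 * η ∧
      |(1 + w') * a + w' * b - ((1 + w) * p + w * q)| ≤ e + 2 * η := by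
  have h1 : ∀ {p a : ℝ}, |a - p| ≤ e → |a| ≤ 3 → |w' * a - w * p| ≤ η := by
    intro p a hp ha
    have : w' * a - w * p = (w' - w) * a + w * (a - p) := by ring
    rw [this]
    refine (abs_add_le _ _).trans ?_
    rw [abs_mul, abs_mul]
    nlinarith [mul_le_mul_of_nonneg_left ha (abs_nonneg (w' - w)),
      mul_le_mul_of_nonneg_left hp (abs_nonneg w)]
  have h2 := abs_le.1 (h1 hp ha)
  have h3 := abs_le.1 (h1 hq hb)
  have h4 := abs_le.1 hp
  have h5 := abs_le.1 hq
  constructor <;> rw [abs_le] <;> constructor <;> linarith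

/-- The output of the evaluation program is precise enough. Half of the permitted error is used by
the final rounding. The errors of the point and, for `n ≤ N`, the omission of the nonlinear part
take the other half. -/
theorem approximates_evalOut {N n : ℕ} {c : ℤ} (hc : 1 ≤ c) (hc' : c ≤ 4) {x : Plane}
    (hx : x ∈ annulus) {φ : ℕ → Fin 2 → DyadicString} (hφ : Represents φ x) :
    Approximates (evalOut N c n (digitsVal (digits (φ (n + 4) 0)))
      (digitsVal (digits (φ (n + 4) 1)))) n (spiralField (scale N) c x) := by
  obtain ⟨hprec, happ⟩ := hφ (n + 4)
  obtain ⟨hx1, hx2⟩ := mem_annulus_iff.1 hx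
  set p := x 0
  set q := x 1
  set a := (φ (n + 4) 0).value with ha
  set b := (φ (n + 4) 1).value with hb
  have hu : (digitsVal (digits (φ (n + 4) 0)) : ℝ) = a * 2 ^ (n + 4) := by
    rw [digitsVal_digits, hprec]
  have hv : (digitsVal (digits (φ (n + 4) 1)) : ℝ) = b * 2 ^ (n + 4) := by
    rw [digitsVal_digits, hprec]
  set u := digitsVal (digits (φ (n + 4) 0))
  set v := digitsVal (digits (φ (n + 4) 1))
  have hpa : |a - p| ≤ (1 / 2) ^ (n + 4) := happ 0
  have hqb : |b - q| ≤ (1 / 2) ^ (n + 4) := happ 1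
  set ε : ℝ := (1 / 2) ^ n with hε
  have hε0 : 0 < ε := by positivity
  have hε1 : ε ≤ 1 := pow_le_one₀ (by norm_num) (by norm_num)
  have e4 : (1 / 2 : ℝ) ^ (n + 4) = ε / 16 := by rw [pow_add, hε]; norm_num; ring
  rw [e4] at hpa hqb
  have hp2 : |p| ≤ 2 := abs_le_of_sq_le_sq (by nlinarith [sq_nonneg q]) (by norm_num)
  have hq2 : |q| ≤ 2 := abs_le_of_sq_le_sq (by nlinarith [sq_nonneg p]) (by norm_num)
  have hpa' := abs_le.1 hpa
  have hqb' := abs_le.1 hqb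
  have hp2' := abs_le.1 hp2
  have hq2' := abs_le.1 hq2
  have ha3 : |a| ≤ 3 := by rw [abs_le]; constructor <;> linarith
  have hb3 : |b| ≤ 3 := by rw [abs_le]; constructor <;> linarith
  set δ := scale N with hδ
  have hδ0 := scale_pos N
  have hδ1 := scale_le N
  have hcr : (1 : ℝ) ≤ c := by exact_mod_cast hc
  have hcr' : (c : ℝ) ≤ 4 := by exact_mod_cast hc'
  set w := δ * (c - p ^ 2 - q ^ 2) with hw
  have hwa : |w| ≤ 3 * δ := by
    rw [hw, abs_mul, abs_of_pos hδ0, mul_comm]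
    refine mul_le_mul_of_nonneg_right ?_ hδ0.le
    rw [abs_le]
    constructor <;> linarith
  -- the factor which the program uses instead of `w`
  set w' : ℝ := factor N c n u v / 2 ^ (2 * n + N + 14) with hw'
  have hη : |w' - w| * 3 + |w| * (ε / 16) ≤ ε * (7 / 32) := by
    by_cases hn : n ≤ N
    · have h0 : w' = 0 := by simp [hw', factor, hn]
      have h1 : δ ≤ ε / 64 := by
        rw [hδ, hε, scale, one_div_pow, pow_add]
        have : (2 : ℝ) ^ n ≤ 2 ^ N := pow_le_pow_right₀ (by norm_num) hn
        rw [div_div]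
        apply one_div_le_one_div_of_le
        · positivity
        · norm_num; linarith
      rw [h0, zero_sub, abs_neg]
      nlinarith [abs_nonneg w]
    · have h0 : w' = δ * (c - a ^ 2 - b ^ 2) := by
        rw [hw', factor, if_neg hn]
        push_cast
        rw [hu, hv, hδ, scale]
        field_simp
        ring
      have h1 : |w' - w| ≤ δ * (10 * (ε / 16)) := by
        have : w' - w = δ * ((p - a) * (p + a) + (q - b) * (q + b)) := by rw [h0, hw]; ring
        rw [this, abs_mul, abs_of_pos hδ0]
        refine mul_le_mul_of_nonneg_left ?_ hδ0.le
        refine (abs_add_le _ _).trans ?_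
        rw [abs_mul, abs_mul, abs_sub_comm p a, abs_sub_comm q b]
        have h2 : |p + a| ≤ 5 := (abs_add_le _ _).trans (by linarith)
        have h3 : |q + b| ≤ 5 := (abs_add_le _ _).trans (by linarith)
        nlinarith [mul_le_mul hpa h2 (abs_nonneg _) (by positivity),
          mul_le_mul hqb h3 (abs_nonneg _) (by positivity)]
      nlinarith [abs_nonneg w, mul_le_mul_of_nonneg_right hδ1 hε0.le]
  obtain ⟨r1, r2⟩ := abs_coord_sub_le hη hpa hqb ha3 hb3
  have key : ∀ (z : ℤ) (y y' : ℝ), (z : ℝ) / 2 ^ (2 * n + N + 17 + 1 + n) = y' →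
      |y' - y| ≤ ε / 16 + 2 * (ε * (7 / 32)) →
      |(roundedString z (2 ^ (2 * n + N + 17)) (2 * n + N + 18) n).value - y| ≤ ε := by
    intro z y y' h1 h2
    have h3 := abs_value_roundedString_sub_le z (2 * n + N + 17) n
    rw [h1] at h3
    have h4 := abs_le.1 h2
    have h5 := abs_le.1 h3
    rw [abs_le]
    constructor <;> linarith
  have hwf : (factor N c n u v : ℝ) = w' * 2 ^ (2 * n + N + 14) := by
    rw [hw']; field_simp
  intro i
  fin_cases i
  · refine key _ _ (w' * a - (1 + w') * b) ?_ r1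
    push_cast
    rw [hwf, hu, hv]
    field_simp
    ring
  · refine key _ _ ((1 + w') * a + w' * b) ?_ r2
    push_cast
    rw [hwf, hu, hv]
    field_simp
    ring

theorem two_pow_le_natOfBits {l : List Bool} (h : l.head? = some true) :
    2 ^ (l.length - 1) ≤ natOfBits l := by
  induction l using List.reverseRecOn with
  | nil => simp at h
  | append_singleton l b ih =>
    rcases l with _ | ⟨a, l⟩
    · simp at h
      subst h
      simp [natOfBits]
    · have := ih (by simpa using h)
      rw [natOfBits_append_singleton]
      simp only [List.length_append, List.length_cons, List.length_nil, Nat.add_sub_cancel,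
        zero_add, pow_succ] at this ⊢
      omega

/-- Leading zeros are not allowed in dyadic strings, so that the oracle's answers are short. -/
theorem length_int_le {s : DyadicString} (h : |s.value| ≤ 3) : s.int.length ≤ 2 := by
  by_contra hlt
  have h1 := s.leading (by omega)
  have h2 : (s.int ++ s.frac).head? = some true := by
    rw [List.head?_append, h1]; rfl
  have h3 := two_pow_le_natOfBits h2
  have h4 : |s.value| = natOfBits (s.int ++ s.frac) / 2 ^ s.frac.length := by
    unfold DyadicString.value
    rw [abs_div, abs_mul, Nat.abs_cast, abs_of_pos (by positivity : (0 : ℝ) < 2 ^ s.frac.length)]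
    split_ifs <;> simp
  rw [h4, div_le_iff₀ (by positivity)] at h
  have h5 : (4 * 2 ^ s.frac.length : ℕ) ≤ 2 ^ ((s.int ++ s.frac).length - 1) := by
    rw [show 4 * 2 ^ s.frac.length = 2 ^ (s.frac.length + 2) by rw [pow_add]; ring]
    exact Nat.pow_le_pow_right (by norm_num) (by simp; omega)
  have h6 : ((4 * 2 ^ s.frac.length : ℕ) : ℝ) ≤ natOfBits (s.int ++ s.frac) := by
    exact_mod_cast h5.trans h3
  push_cast at h6
  have : (0 : ℝ) < 2 ^ s.frac.length := by positivity
  linarith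

theorem prec_evalOut (N : ℕ) (c : ℤ) (n : ℕ) (u v : ℤ) (i : Fin 2) :
    (evalOut N c n u v i).prec = n := by
  fin_cases i <;> exact prec_mkDyadic _ _ _

theorem computesInPolyTime_evalProg (N : ℕ) (c : List Symb) (hc : 1 ≤ digitsVal c)
    (hc' : digitsVal c ≤ 4) :
    ComputesInPolyTime (machine (evalProg N c)) annulus
      (spiralField (scale N) (digitsVal c : ℤ)) := by
  refine ⟨Polynomial.C 100000000 * (Polynomial.C 12 * Polynomial.X +
    Polynomial.C (4 * N + c.length + 112)) ^ 2, fun x hx φ hφ n => ?_⟩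
  refine ⟨_, prec_evalOut N (digitsVal c) n _ _, approximates_evalOut hc hc' hx hφ, ?_⟩
  have hlen : ∀ i : Fin 2, (digits (φ (n + 4) i)).length ≤ n + 6 := by
    intro i
    rw [length_digits, (hφ (n + 4)).1 i]
    have h1 := (hφ (n + 4)).2 i
    have h2 : (1 / 2 : ℝ) ^ (n + 4) ≤ 1 := pow_le_one₀ (by norm_num) (by norm_num)
    obtain ⟨hx1, hx2⟩ := mem_annulus_iff.1 hx
    have h3 : |x i| ≤ 2 := by
      refine abs_le_of_sq_le_sq ?_ (by norm_num)
      fin_cases i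
      · simp only [Fin.zero_eta]; nlinarith [sq_nonneg (x 1)]
      · simp only [Fin.mk_one]; nlinarith [sq_nonneg (x 0)]
    have h4 : |(φ (n + 4) i).value| ≤ 3 := by
      have h5 := abs_le.1 h1
      have h6 := abs_le.1 h3
      rw [abs_le]
      constructor <;> linarith
    have := length_int_le h4
    omega
  have h := outputsWithin_evalProg N c φ n (12 * n + (4 * N + c.length + 112))
    (by have := hlen 0; have := hlen 1; omega)
  simpa using h

/-! ### Dynamics of the vector fields -/

theorem hasDerivWithinAt_plane {γ : ℝ → Plane} {v : Plane} {I : Set ℝ} {t : ℝ} :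
    HasDerivWithinAt γ v I t ↔ ∀ i, HasDerivWithinAt (fun t => γ t i) (v i) I t := by
  rw [hasDerivWithinAt_iff_hasFDerivWithinAt, hasFDerivWithinAt_euclidean]
  refine forall_congr' fun i => ?_
  rw [hasDerivWithinAt_iff_hasFDerivWithinAt]
  have : PiLp.proj 2 (fun _ : Fin 2 => ℝ) i ∘L ContinuousLinearMap.toSpanSingleton ℝ v =
      ContinuousLinearMap.toSpanSingleton ℝ (v i) := by
    ext
    simp
  rw [← this]

/-- The circle around the origin with squared radius `c`. -/
def circleSq (c : ℝ) : Set Plane := {x | x 0 ^ 2 + x 1 ^ 2 = c}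

/-- The point with polar coordinates `exp l` and `θ`. -/
noncomputable def polar (l θ : ℝ) : Plane := !₂[Real.exp l * Real.cos θ, Real.exp l * Real.sin θ]

theorem polar_sq (l θ : ℝ) : polar l θ 0 ^ 2 + polar l θ 1 ^ 2 = Real.exp (2 * l) := by
  simp only [polar, two_mul, Real.exp_add, PiLp.toLp_apply, Matrix.cons_val_zero,
    Matrix.cons_val_one]
  nlinarith [Real.sin_sq_add_cos_sq θ]

theorem exists_polar {x : Plane} {c : ℝ} (hc : 0 < c) (hx : x ∈ circleSq c) :
    ∃ θ, x = polar (Real.log c / 2) θ := by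
  refine ⟨Complex.arg ⟨x 0, x 1⟩, ?_⟩
  have h1 : Real.exp (Real.log c / 2) = ‖(⟨x 0, x 1⟩ : ℂ)‖ := by
    rw [Complex.norm_def, Complex.normSq_mk, ← sq, ← sq, show x 0 ^ 2 + x 1 ^ 2 = c from hx,
      Real.sqrt_eq_rpow, Real.rpow_def_of_pos hc]
    ring_nf
  ext i
  simp only [polar, h1]
  fin_cases i
  · simp [Complex.norm_mul_cos_arg]
  · simp [Complex.norm_mul_sin_arg]

theorem continuous_polar : Continuous fun p : ℝ × ℝ => polar p.1 p.2 := by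
  unfold polar
  refine (PiLp.continuous_toLp 2 _).comp (continuous_pi fun i => ?_)
  fin_cases i
  · simp only [Fin.zero_eta, Matrix.cons_val_zero]; fun_prop
  · simp only [Fin.mk_one, Matrix.cons_val_one]; fun_prop

theorem spiralField_polar_apply (δ c l θ : ℝ) :
    spiralField δ c (polar l θ) =
      !₂[δ * (c - Real.exp (2 * l)) * (Real.exp l * Real.cos θ) -
          (1 + δ * (c - Real.exp (2 * l))) * (Real.exp l * Real.sin θ),
        (1 + δ * (c - Real.exp (2 * l))) * (Real.exp l * Real.cos θ) +
          δ * (c - Real.exp (2 * l)) * (Real.exp l * Real.sin θ)] := by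
  have h := polar_sq l θ
  have h' : c - polar l θ 0 ^ 2 - polar l θ 1 ^ 2 = c - Real.exp (2 * l) := by rw [← h]; ring
  unfold spiralField
  rw [h']
  rfl

/-- Along a solution, the logarithm `l` of the radius and the angle `θ` satisfy
`l' = δ (c - exp (2 l))` and `θ' = 1 + l'`. -/
theorem hasDerivAt_polar {δ c : ℝ} {l θ : ℝ → ℝ} {t : ℝ}
    (hl : HasDerivAt l (δ * (c - Real.exp (2 * l t))) t)
    (hθ : HasDerivAt θ (1 + δ * (c - Real.exp (2 * l t))) t) (I : Set ℝ) :
    HasDerivWithinAt (fun t => polar (l t) (θ t)) (spiralField δ c (polar (l t) (θ t))) I t := by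
  rw [hasDerivWithinAt_plane, spiralField_polar_apply]
  intro i
  refine HasDerivAt.hasDerivWithinAt ?_
  fin_cases i
  · have := hl.exp.mul hθ.cos
    refine (this.congr_deriv ?_)
    simp
    ring
  · have := hl.exp.mul hθ.sin
    refine (this.congr_deriv ?_)
    simp
    ring

/-- The inverse of the squared radius along the solution starting at squared radius `s`: it solves
a linear equation. -/
noncomputable def invSq (δ c s t : ℝ) : ℝ := 1 / c + (1 / s - 1 / c) * Real.exp (-(2 * δ * c * t))

/-- The logarithm of the radius along the solution starting at squared radius `s`. -/
noncomputable def logRadius (δ c s t : ℝ) : ℝ := -Real.log (invSq δ c s t) / 2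

/-- The solution starting at squared radius `s`, with a phase `α`. -/
noncomputable def spiral (δ c s α t : ℝ) : Plane :=
  polar (logRadius δ c s t) (t + logRadius δ c s t + α)

theorem hasDerivAt_invSq {δ c : ℝ} (hc : 0 < c) (s t : ℝ) :
    HasDerivAt (invSq δ c s) (-(2 * δ) * (c * invSq δ c s t - 1)) t := by
  have h1 : HasDerivAt (fun t : ℝ => -(2 * δ * c * t)) (-(2 * δ * c)) t := by
    exact ((hasDerivAt_id t).const_mul (2 * δ * c)).neg.congr_deriv (by simp)
  have h := (h1.exp.const_mul (1 / s - 1 / c)).const_add (1 / c)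
  refine h.congr_deriv ?_
  unfold invSq
  field_simp
  ring

theorem exp_two_mul_logRadius {δ c s t : ℝ} (h : 0 < invSq δ c s t) :
    Real.exp (2 * logRadius δ c s t) = 1 / invSq δ c s t := by
  unfold logRadius
  rw [show 2 * (-Real.log (invSq δ c s t) / 2) = -Real.log (invSq δ c s t) by ring, Real.exp_neg,
    Real.exp_log h, one_div]

theorem hasDerivWithinAt_spiral {δ c : ℝ} (hc : 0 < c) {s t : ℝ} (h : 0 < invSq δ c s t) (α : ℝ)
    (I : Set ℝ) :
    HasDerivWithinAt (spiral δ c s α) (spiralField δ c (spiral δ c s α t)) I t := by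
  have hl : HasDerivAt (logRadius δ c s) (δ * (c - Real.exp (2 * logRadius δ c s t))) t := by
    refine (((hasDerivAt_invSq hc s t).log h.ne').neg.div_const 2).congr_deriv ?_
    rw [exp_two_mul_logRadius h]
    field_simp
  refine hasDerivAt_polar hl ?_ I
  exact (((hasDerivAt_id t).add hl).add_const α)

theorem invSq_mem {δ c s t : ℝ} (hδ : 0 < δ) (hc : 1 ≤ c) (hc' : c ≤ 4) (hs : 1 ≤ s) (hs' : s ≤ 4)
    (ht : 0 ≤ t) : 1 / 4 ≤ invSq δ c s t ∧ invSq δ c s t ≤ 1 := by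
  have h1 : Real.exp (-(2 * δ * c * t)) ≤ 1 := by
    rw [Real.exp_le_one_iff]
    have : 0 ≤ 2 * δ * c * t := by positivity
    linarith
  have h2 := Real.exp_pos (-(2 * δ * c * t))
  have h3 : ∀ {a : ℝ}, 1 ≤ a → a ≤ 4 → 1 / 4 ≤ 1 / a ∧ 1 / a ≤ 1 := fun {a} h h' => by
    rw [div_le_div_iff₀ (by norm_num) (by linarith), div_le_one (by linarith)]
    constructor <;> linarith
  obtain ⟨h4, h5⟩ := h3 hc hc'
  obtain ⟨h6, h7⟩ := h3 hs hs'
  unfold invSq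
  generalize Real.exp (-(2 * δ * c * t)) = E at *
  constructor <;> nlinarith

theorem polar_mem_annulus_iff {l θ : ℝ} :
    polar l θ ∈ annulus ↔ 1 ≤ Real.exp (2 * l) ∧ Real.exp (2 * l) ≤ 4 := by
  rw [mem_annulus_iff, polar_sq]

theorem isTrajectory_spiral {δ c s : ℝ} (hδ : 0 < δ) (hc : 1 ≤ c) (hc' : c ≤ 4) (hs : 1 ≤ s)
    (hs' : s ≤ 4) (α : ℝ) :
    IsTrajectory (spiralField δ c) annulus (Ici 0) (spiral δ c s α) := by
  intro t ht
  obtain ⟨h1, h2⟩ := invSq_mem hδ hc hc' hs hs' ht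
  refine ⟨?_, hasDerivWithinAt_spiral (by linarith) (by linarith) α _⟩
  rw [spiral, polar_mem_annulus_iff, exp_two_mul_logRadius (by linarith), le_div_iff₀ (by linarith),
    div_le_iff₀ (by linarith)]
  constructor <;> linarith

theorem invSq_self {c : ℝ} (δ t : ℝ) : invSq δ c c t = 1 / c := by simp [invSq]

theorem logRadius_self {c : ℝ} (δ t : ℝ) : logRadius δ c c t = Real.log c / 2 := by
  simp [logRadius, invSq_self]

theorem polar_mem_circleSq {c : ℝ} (hc : 0 < c) (θ : ℝ) :
    polar (Real.log c / 2) θ ∈ circleSq c := by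
  change _ = _
  rw [polar_sq, mul_div_cancel₀ _ two_ne_zero, Real.exp_log hc]

theorem isClosedOrbit_circleSq {δ c : ℝ} (hc : 1 ≤ c) (hc' : c ≤ 4) :
    IsClosedOrbit (spiralField δ c) annulus (circleSq c) := by
  have hc0 : 0 < c := by linarith
  have e : ∀ t, spiral δ c c (-(Real.log c / 2)) t = polar (Real.log c / 2) t := by
    intro t
    simp [spiral, logRadius_self]
  refine ⟨spiral δ c c (-(Real.log c / 2)), fun t _ => ⟨?_, ?_⟩, ⟨2 * Real.pi, by positivity, ?_⟩,
    ⟨Real.pi, ?_⟩, ?_⟩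
  · rw [e, mem_annulus_iff, polar_mem_circleSq hc0]
    exact ⟨hc, hc'⟩
  · exact hasDerivWithinAt_spiral hc0 (by rw [invSq_self]; positivity) _ _
  · intro t
    simp only [e, polar, Real.cos_add_two_pi, Real.sin_add_two_pi]
  · rw [e, e]
    intro h
    have h0 := congrArg (fun x : Plane => x 0) h
    have := Real.exp_pos (Real.log c / 2)
    simp [polar] at h0
    linarith
  · ext x
    constructor
    · intro hx
      obtain ⟨θ, rfl⟩ := exists_polar hc0 hx
      exact ⟨θ, e θ⟩
    · rintro ⟨t, rfl⟩
      rw [e]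
      exact polar_mem_circleSq hc0 t

/-- Every closed orbit of the field in the annulus is the circle with squared radius `c`: the
squared distance of `|γ|²` from `c` is nonincreasing, and periodic. -/
theorem eq_circleSq_of_isClosedOrbit {δ c : ℝ} (hδ : 0 < δ) (hc : 1 ≤ c) {C : Set Plane}
    (hC : IsClosedOrbit (spiralField δ c) annulus C) : C = circleSq c := by
  obtain ⟨γ, hγ, ⟨p, hp, hper⟩, -, rfl⟩ := hC
  have hd : ∀ t i, HasDerivAt (fun t => γ t i) (spiralField δ c (γ t) i) t := fun t i =>
    (hasDerivWithinAt_plane.1 (hγ t (mem_univ t)).2 i).hasDerivAt univ_mem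
  have hT : ∀ t, 1 ≤ γ t 0 ^ 2 + γ t 1 ^ 2 := fun t => (mem_annulus_iff.1 (hγ t (mem_univ t)).1).1
  set g : ℝ → ℝ := fun t => (γ t 0 ^ 2 + γ t 1 ^ 2 - c) ^ 2 with hg
  have hgd : ∀ t, HasDerivAt g (-(4 * δ * (γ t 0 ^ 2 + γ t 1 ^ 2) * g t)) t := by
    intro t
    refine (((((hd t 0).pow 2).add ((hd t 1).pow 2)).sub_const c).pow 2).congr_deriv ?_
    simp [spiralField, hg]
    ring
  have hanti : Antitone g := by
    refine antitone_of_deriv_nonpos (fun t => (hgd t).differentiableAt) fun t => ?_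
    rw [(hgd t).deriv]
    have := hT t
    have h2 : 0 ≤ g t := sq_nonneg _
    have : 0 ≤ 4 * δ * (γ t 0 ^ 2 + γ t 1 ^ 2) * g t := by positivity
    linarith
  have hgper : Function.Periodic g p := fun t => by simp only [hg, hper t]
  have hconst : ∀ t, g t = g 0 := by
    intro t
    obtain ⟨n, hn⟩ := exists_nat_gt (|t| / p)
    rw [div_lt_iff₀ hp] at hn
    have h1 : g (n * p) = g 0 := by simpa using hgper.nat_mul n 0
    have h2 : g (-(n * p)) = g 0 := by
      have := hgper.nat_mul n (-(n * p))
      rw [← this]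
      simp
    refine le_antisymm ?_ ?_
    · rw [← h2]
      exact hanti (by have := neg_abs_le t; linarith)
    · rw [← h1]
      exact hanti (by have := le_abs_self t; linarith)
  have hzero : ∀ t, γ t 0 ^ 2 + γ t 1 ^ 2 = c := by
    intro t
    have h1 : HasDerivAt g 0 t := by
      have : g = fun _ => g 0 := funext hconst
      rw [this]
      exact hasDerivAt_const t _
    have h2 := (hgd t).unique h1
    have h3 := hT t
    have h4 : g t = 0 := by
      have h5 : (4 * δ * (γ t 0 ^ 2 + γ t 1 ^ 2)) * g t = 0 := by linarith
      exact (mul_eq_zero.1 h5).resolve_left (by positivity)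
    have h6 := pow_eq_zero_iff (two_ne_zero) |>.1 h4
    linarith
  -- on the circle, the field is that of the rotations
  have h0 : ∀ t, HasDerivAt (fun t => γ t 0) (-γ t 1) t := fun t => by
    refine (hd t 0).congr_deriv ?_
    have : c - γ t 0 ^ 2 - γ t 1 ^ 2 = 0 := by linarith [hzero t]
    simp [spiralField, this]
  have h1 : ∀ t, HasDerivAt (fun t => γ t 1) (γ t 0) t := fun t => by
    refine (hd t 1).congr_deriv ?_
    have : c - γ t 0 ^ 2 - γ t 1 ^ 2 = 0 := by linarith [hzero t]
    simp [spiralField, this]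
  have hu : ∀ t, γ t 0 * Real.cos t + γ t 1 * Real.sin t = γ 0 0 := by
    intro t
    have := is_const_of_deriv_eq_zero (f := fun t => γ t 0 * Real.cos t + γ t 1 * Real.sin t)
      (fun t => (((h0 t).mul (Real.hasDerivAt_cos t)).add
        ((h1 t).mul (Real.hasDerivAt_sin t))).differentiableAt) (fun t => by
        refine ((((h0 t).mul (Real.hasDerivAt_cos t)).add
          ((h1 t).mul (Real.hasDerivAt_sin t))).deriv).trans ?_
        ring) t 0
    simpa using this
  have hv : ∀ t, γ t 1 * Real.cos t - γ t 0 * Real.sin t = γ 0 1 := by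
    intro t
    have := is_const_of_deriv_eq_zero (f := fun t => γ t 1 * Real.cos t - γ t 0 * Real.sin t)
      (fun t => (((h1 t).mul (Real.hasDerivAt_cos t)).sub
        ((h0 t).mul (Real.hasDerivAt_sin t))).differentiableAt) (fun t => by
        refine ((((h1 t).mul (Real.hasDerivAt_cos t)).sub
          ((h0 t).mul (Real.hasDerivAt_sin t))).deriv).trans ?_
        ring) t 0
    simpa using this
  have hc0 : 0 < c := by linarith
  obtain ⟨α, hα⟩ := exists_polar hc0 (show γ 0 ∈ circleSq c from hzero 0)
  have hform : ∀ t, γ t = polar (Real.log c / 2) (α + t) := by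
    intro t
    have e0 : γ 0 0 = Real.exp (Real.log c / 2) * Real.cos α := by rw [hα]; simp [polar]
    have e1 : γ 0 1 = Real.exp (Real.log c / 2) * Real.sin α := by rw [hα]; simp [polar]
    have hu' := hu t
    have hv' := hv t
    rw [e0] at hu'
    rw [e1] at hv'
    have hsc := Real.sin_sq_add_cos_sq t
    ext i
    fin_cases i
    · simp only [polar, Real.cos_add, Real.sin_add, Fin.zero_eta, PiLp.toLp_apply,
        Matrix.cons_val_zero]
      linear_combination Real.cos t * hu' - Real.sin t * hv' - γ t 0 * hsc
    · simp only [polar, Real.cos_add, Real.sin_add, Fin.mk_one, PiLp.toLp_apply,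
        Matrix.cons_val_one, Matrix.cons_val_fin_one]
      linear_combination Real.sin t * hu' + Real.cos t * hv' - γ t 1 * hsc
  ext x
  constructor
  · rintro ⟨t, rfl⟩
    exact hzero t
  · intro hx
    obtain ⟨θ, rfl⟩ := exists_polar hc0 hx
    exact ⟨θ - α, by rw [hform]; congr 1; ring⟩

theorem tendsto_logRadius {δ c : ℝ} (hδ : 0 < δ) (hc : 0 < c) (s : ℝ) :
    Tendsto (logRadius δ c s) atTop (𝓝 (Real.log c / 2)) := by
  have h1 : Tendsto (fun t : ℝ => Real.exp (-(2 * δ * c * t))) atTop (𝓝 0) := by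
    refine Real.tendsto_exp_neg_atTop_nhds_zero.comp ?_
    exact tendsto_id.const_mul_atTop (by positivity)
  have h2 : Tendsto (invSq δ c s) atTop (𝓝 (1 / c)) := by
    have := (h1.const_mul (1 / s - 1 / c)).const_add (1 / c)
    rw [mul_zero, add_zero] at this
    exact this
  have h3 := ((h2.log (by positivity)).neg.div_const 2)
  have e : -Real.log (1 / c) / 2 = Real.log c / 2 := by simp
  rw [e] at h3
  exact h3

/-- The `ω`-limit set of each spiral is the circle with squared radius `c`. -/
theorem omegaLimit_spiral {δ c : ℝ} (hδ : 0 < δ) (hc : 0 < c) (s α : ℝ) :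
    {y | MapClusterPt y atTop (spiral δ c s α)} = circleSq c := by
  have hl := tendsto_logRadius hδ hc s
  ext y
  constructor
  · intro hy
    have hcont : ContinuousAt (fun x : Plane => x 0 ^ 2 + x 1 ^ 2) y := by fun_prop
    have h1 := MapClusterPt.continuousAt_comp hcont hy
    have h2 : Tendsto ((fun x : Plane => x 0 ^ 2 + x 1 ^ 2) ∘ spiral δ c s α) atTop (𝓝 c) := by
      have e : (fun x : Plane => x 0 ^ 2 + x 1 ^ 2) ∘ spiral δ c s α =
          fun t => Real.exp (2 * logRadius δ c s t) := by
        funext t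
        exact polar_sq _ _
      rw [e]
      have h3 := (Real.continuous_exp.tendsto _).comp (hl.const_mul 2)
      rwa [mul_div_cancel₀ _ two_ne_zero, Real.exp_log hc] at h3
    have h3 : (𝓝 ((fun x : Plane => x 0 ^ 2 + x 1 ^ 2) y) ⊓ 𝓝 c).NeBot :=
      NeBot.mono h1 (inf_le_inf_left _ h2)
    exact eq_of_nhds_neBot h3
  · intro hy
    obtain ⟨θ, rfl⟩ := exists_polar hc hy
    -- the times at which the limiting phase is that of the given point
    set τ : ℕ → ℝ := fun k => (θ - Real.log c / 2 - α) + k * (2 * Real.pi) with hτ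
    have hτt : Tendsto τ atTop atTop := by
      refine tendsto_atTop_add_const_left _ _ ?_
      exact tendsto_natCast_atTop_atTop.atTop_mul_const (by positivity)
    refine MapClusterPt.of_comp hτt (Tendsto.mapClusterPt ?_)
    have h1 : Tendsto (fun k => (logRadius δ c s (τ k),
        θ + (logRadius δ c s (τ k) - Real.log c / 2))) atTop (𝓝 (Real.log c / 2, θ)) := by
      have h2 := hl.comp hτt
      refine Tendsto.prodMk_nhds h2 ?_
      have h3 := (h2.sub_const (Real.log c / 2)).const_add θ
      simpa using h3
    have h2 := (continuous_polar.tendsto (Real.log c / 2, θ)).comp h1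
    refine h2.congr fun k => ?_
    simp only [Function.comp_apply, spiral]
    have e : τ k + logRadius δ c s (τ k) + α =
        θ + (logRadius δ c s (τ k) - Real.log c / 2) + k * (2 * Real.pi) := by
      rw [hτ]; ring
    rw [e]
    simp only [polar, Real.cos_add_nat_mul_two_pi, Real.sin_add_nat_mul_two_pi]

theorem isLimitCycle_circleSq {δ c : ℝ} (hδ : 0 < δ) (hc : 1 ≤ c) (hc' : c ≤ 4) :
    IsLimitCycle (spiralField δ c) annulus (circleSq c) := by
  obtain ⟨s, hs, hs', hsc⟩ : ∃ s : ℝ, 1 ≤ s ∧ s ≤ 4 ∧ s ≠ c := by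
    by_cases h : c = 1
    · exact ⟨4, by norm_num, le_rfl, by rw [h]; norm_num⟩
    · exact ⟨1, le_rfl, by norm_num, Ne.symm h⟩
  refine ⟨isClosedOrbit_circleSq hc hc', spiral δ c s 0, ?_,
    Or.inl ⟨isTrajectory_spiral hδ hc hc' hs hs' 0, omegaLimit_spiral hδ (by linarith) s 0⟩⟩
  intro h
  have h0 : invSq δ c s 0 = 1 / s := by simp [invSq]
  change polar _ _ 0 ^ 2 + polar _ _ 1 ^ 2 = c at h
  rw [polar_sq, exp_two_mul_logRadius (by rw [h0]; positivity), h0, one_div_one_div] at h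
  exact hsc h

theorem mapsTo_spiralField {δ c : ℝ} (hδ : 0 < δ) (hδ' : δ ≤ 1 / 64) (hc : 1 ≤ c) (hc' : c ≤ 4) :
    MapsTo (spiralField δ c) annulus annulus := by
  intro x hx
  rw [mem_annulus_iff] at hx ⊢
  obtain ⟨h1, h2⟩ := hx
  set s := x 0 ^ 2 + x 1 ^ 2 with hs
  set w := δ * (c - x 0 ^ 2 - x 1 ^ 2) with hw
  have e : spiralField δ c x 0 ^ 2 + spiralField δ c x 1 ^ 2 = s * (1 + 2 * w + 2 * w ^ 2) := by
    simp only [spiralField, PiLp.toLp_apply, Matrix.cons_val_zero, Matrix.cons_val_one, hs, hw]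
    ring
  have hw' : w = δ * (c - s) := by rw [hw, hs]; ring
  rw [e]
  constructor
  · have h3 : -((s - 1) / 64) ≤ w := by
      rw [hw']
      nlinarith
    nlinarith [mul_nonneg (sub_nonneg.2 h1) (sub_nonneg.2 h2), sq_nonneg w]
  · have h3 : w ≤ (4 - s) / 64 := by
      rw [hw']
      nlinarith
    have h4 : -(3 / 64) ≤ w := by
      rw [hw']
      nlinarith
    rcases le_or_gt w 0 with h5 | h5
    · nlinarith [mul_nonneg (neg_nonneg.2 h5) (by linarith : 0 ≤ 1 + w)]
    · have h6 : w ^ 2 ≤ w / 16 := by nlinarith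
      nlinarith [mul_nonneg (sub_nonneg.2 h1) (sub_nonneg.2 h2)]

theorem lipschitzOnWith_spiralField {δ c : ℝ} (hδ : 0 < δ) (hδ' : δ ≤ 1 / 64) (hc : 1 ≤ c)
    (hc' : c ≤ 4) : LipschitzOnWith 3 (spiralField δ c) annulus := by
  refine LipschitzOnWith.of_dist_le_mul fun x hx y hy => ?_
  have hcoord : ∀ {z : Plane}, z ∈ annulus → ∀ i, |z i| ≤ 2 := fun {z} hz i =>
    (by simpa using PiLp.norm_apply_le z i : |z i| ≤ ‖z‖).trans hz.2
  have hdiff : ∀ i, |x i - y i| ≤ dist x y := fun i => by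
    simpa [dist_eq_norm] using PiLp.norm_apply_le (x - y) i
  set e := dist x y with he
  have he0 : 0 ≤ e := dist_nonneg
  obtain ⟨hy1, hy2⟩ := mem_annulus_iff.1 hy
  have hx0 := hcoord hx 0
  have hx1 := hcoord hx 1
  have hy0 := hcoord hy 0
  have hy1' := hcoord hy 1
  have hd0 := hdiff 0
  have hd1 := hdiff 1
  have hη : |δ * (c - x 0 ^ 2 - x 1 ^ 2) - δ * (c - y 0 ^ 2 - y 1 ^ 2)| * 3 +
      |δ * (c - y 0 ^ 2 - y 1 ^ 2)| * e ≤ e / 2 := by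
    have h1 : |δ * (c - y 0 ^ 2 - y 1 ^ 2)| ≤ 3 / 64 := by
      rw [abs_mul, abs_of_pos hδ]
      have : |c - y 0 ^ 2 - y 1 ^ 2| ≤ 3 := by rw [abs_le]; constructor <;> linarith
      nlinarith [abs_nonneg (c - y 0 ^ 2 - y 1 ^ 2)]
    have h2 : |δ * (c - x 0 ^ 2 - x 1 ^ 2) - δ * (c - y 0 ^ 2 - y 1 ^ 2)| ≤ 8 * e / 64 := by
      have h3 : δ * (c - x 0 ^ 2 - x 1 ^ 2) - δ * (c - y 0 ^ 2 - y 1 ^ 2) =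
          δ * ((y 0 - x 0) * (y 0 + x 0) + (y 1 - x 1) * (y 1 + x 1)) := by ring
      rw [h3, abs_mul, abs_of_pos hδ]
      have h4 : |(y 0 - x 0) * (y 0 + x 0) + (y 1 - x 1) * (y 1 + x 1)| ≤ 8 * e := by
        refine (abs_add_le _ _).trans ?_
        rw [abs_mul, abs_mul, abs_sub_comm (y 0), abs_sub_comm (y 1)]
        have h5 : |y 0 + x 0| ≤ 4 := (abs_add_le _ _).trans (by linarith)
        have h6 : |y 1 + x 1| ≤ 4 := (abs_add_le _ _).trans (by linarith)
        nlinarith [mul_le_mul hd0 h5 (abs_nonneg _) he0, mul_le_mul hd1 h6 (abs_nonneg _) he0]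
      nlinarith [abs_nonneg ((y 0 - x 0) * (y 0 + x 0) + (y 1 - x 1) * (y 1 + x 1))]
    nlinarith
  obtain ⟨r0, r1⟩ := abs_coord_sub_le hη hd0 hd1 (by linarith) (by linarith)
  have r0' := abs_le.1 r0
  have r1' := abs_le.1 r1
  rw [EuclideanSpace.dist_eq, Fin.sum_univ_two]
  refine Real.sqrt_le_iff.2 ⟨by simpa using he0, ?_⟩
  rw [Real.dist_eq, Real.dist_eq, sq_abs, sq_abs]
  have k0 : (spiralField δ c x 0 - spiralField δ c y 0) ^ 2 ≤ (e + 2 * (e / 2)) ^ 2 := by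
    rw [← sq_abs]
    exact pow_le_pow_left₀ (abs_nonneg _) r0 2
  have k1 : (spiralField δ c x 1 - spiralField δ c y 1) ^ 2 ≤ (e + 2 * (e / 2)) ^ 2 := by
    rw [← sq_abs]
    exact pow_le_pow_left₀ (abs_nonneg _) r1 2
  simp only [NNReal.coe_ofNat]
  nlinarith

theorem contDiff_spiralField (δ c : ℝ) : ContDiff ℝ 1 (spiralField δ c) := by
  have h : ∀ i : Fin 2, ContDiff ℝ 1 fun x : Plane => x i := fun i =>
    contDiff_euclidean.1 contDiff_id i
  have h0 := h 0
  have h1 := h 1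
  rw [contDiff_euclidean]
  intro i
  fin_cases i
  · simp only [spiralField, Fin.zero_eta, PiLp.toLp_apply, Matrix.cons_val_zero]; fun_prop
  · simp only [spiralField, Fin.mk_one, PiLp.toLp_apply, Matrix.cons_val_one,
      Matrix.cons_val_fin_one]
    fun_prop

theorem isInstance_spiralField {δ c : ℝ} (hδ : 0 < δ) (hδ' : δ ≤ 1 / 64) (hc : 1 ≤ c)
    (hc' : c ≤ 4) : IsInstance 3 annulus (spiralField δ c) where
  mapsTo := mapsTo_spiralField hδ hδ' hc hc'
  lipschitz := lipschitzOnWith_spiralField hδ hδ' hc hc'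
  contDiff := (contDiff_spiralField δ c).contDiffOn
  no_fixpoint x hx h := by
    have := (mapsTo_spiralField hδ hδ' hc hc' hx).1
    rw [h, norm_zero] at this
    linarith
  invariant x hx := by
    obtain ⟨h1, h2⟩ := mem_annulus_iff.1 hx
    set s := x 0 ^ 2 + x 1 ^ 2 with hs
    obtain ⟨θ, hθ⟩ := exists_polar (x := x) (c := s) (by linarith) rfl
    refine ⟨spiral δ c s (θ - Real.log s / 2), ?_, isTrajectory_spiral hδ hc hc' h1 h2 _⟩
    have h0 : logRadius δ c s 0 = Real.log s / 2 := by simp [logRadius, invSq]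
    rw [spiral, h0, hθ]
    congr 1
    ring
  exists_limitCycle := ⟨_, isLimitCycle_circleSq hδ hc hc'⟩
  closedOrbit_unique C C' h h' := by
    rw [eq_circleSq_of_isClosedOrbit hδ hc h, eq_circleSq_of_isClosedOrbit hδ hc h']

theorem onLimitCycle_spiralField {δ c : ℝ} (hδ : 0 < δ) (hc : 1 ≤ c) (hc' : c ≤ 4) :
    onLimitCycle (spiralField δ c) annulus = circleSq c := by
  ext x
  constructor
  · rintro ⟨C, hC, hx⟩
    rwa [eq_circleSq_of_isClosedOrbit hδ hc hC.1] at hx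
  · exact fun hx => ⟨_, isLimitCycle_circleSq hδ hc hc', hx⟩

/-! ### Indistinguishable inputs -/

/-- For precision `n ≤ N` the output does not depend on the parameters of the vector field. -/
theorem evalOut_of_le {N n : ℕ} (h : n ≤ N) (c u v : ℤ) :
    evalOut N c n u v = ![mkDyadic (decide (0 < v)) ((v.natAbs + 8) / 16) n,
      mkDyadic (decide (u < 0)) ((u.natAbs + 8) / 16) n] := by
  have hpow : (0 : ℤ) < 2 ^ (2 * n + N + 14) := by positivity
  have hdiv : ∀ a : ℕ, (2 ^ (2 * n + N + 14) * a + 2 ^ (2 * n + N + 17)) / 2 ^ (2 * n + N + 18) =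
      (a + 8) / 16 := by
    intro a
    rw [show 2 ^ (2 * n + N + 14) * a + 2 ^ (2 * n + N + 17) = 2 ^ (2 * n + N + 14) * (a + 8) by
      ring, show 2 ^ (2 * n + N + 18) = 2 ^ (2 * n + N + 14) * 16 by ring,
      Nat.mul_div_mul_left _ _ (by positivity)]
  have habs : ∀ a : ℤ, (2 ^ (2 * n + N + 14) * a).natAbs = 2 ^ (2 * n + N + 14) * a.natAbs := by
    intro a
    rw [Int.natAbs_mul, Int.natAbs_pow]
    rfl
  have h1 : roundedString (0 * u - (2 ^ (2 * n + N + 14) + 0) * v) (2 ^ (2 * n + N + 17))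
      (2 * n + N + 18) n = mkDyadic (decide (0 < v)) ((v.natAbs + 8) / 16) n := by
    rw [roundedString, zero_mul, zero_sub, add_zero, Int.natAbs_neg, habs, hdiv]
    congr 2
    rw [neg_lt_zero, mul_pos_iff_of_pos_left hpow]
  have h2 : roundedString ((2 ^ (2 * n + N + 14) + 0) * u + 0 * v) (2 ^ (2 * n + N + 17))
      (2 * n + N + 18) n = mkDyadic (decide (u < 0)) ((u.natAbs + 8) / 16) n := by
    rw [roundedString, zero_mul, add_zero, add_zero, habs, hdiv]
    congr 2
    rw [mul_neg_iff, eq_iff_iff]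
    simp [hpow, hpow.not_gt]
  rw [evalOut, factor, if_pos h, h1, h2]

theorem exists_outputsWithin_evalProg_iff (N : ℕ) (c : List Symb) (φ : ℕ → Fin 2 → DyadicString)
    (n : ℕ) (out : List Symb) :
    (∃ t, (machine (evalProg N c)).OutputsWithin (nameOracle φ) (unary n) t out) ↔
      out = encodeTuple (evalOut N (digitsVal c) n (digitsVal (digits (φ (n + 4) 0)))
        (digitsVal (digits (φ (n + 4) 1)))) := by
  have h := outputsWithin_evalProg N c φ n _ le_rfl
  constructor
  · rintro ⟨t, ht⟩
    exact ht.unique h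
  · rintro rfl
    exact ⟨_, h⟩

open Classical in
theorem dite_choose_congr {α : Type*} {p q : α → Prop} (a : α) (h : ∀ x, p x ↔ q x) :
    (if h : ∃ x, p x then h.choose else a) = if h : ∃ x, q x then h.choose else a := by
  obtain rfl : p = q := funext fun x => propext (h x)
  rfl

/-- The black boxes for the vector fields give the same answers to short queries. -/
theorem blackBox_evalProg_congr {N N' : ℕ} (c c' : List Symb) {w : List Symb} (h : w.length ≤ N)
    (h' : w.length ≤ N') :
    blackBox 2 (machine (evalProg N c)) w = blackBox 2 (machine (evalProg N' c')) w := by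
  unfold blackBox
  refine dite_choose_congr _ fun out => ?_
  refine exists_congr fun q => exists_congr fun m => ?_
  rw [exists_and_left, exists_and_left]
  refine and_congr_right fun hw => ?_
  have hm : m ≤ w.length := by rw [hw]; simp
  rw [exists_outputsWithin_evalProg_iff, exists_outputsWithin_evalProg_iff,
    evalOut_of_le (hm.trans h), evalOut_of_le (hm.trans h')]

theorem OracleTM.next_congr (M : OracleTM) {O O' : List Symb → List Symb} (C : M.Cfg)
    (h : O (C.stk (Sum.inl Port.query)) = O' (C.stk (Sum.inl Port.query))) :
    M.next O C = M.next O' C := by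
  obtain ⟨_ | l, v, S⟩ := C
  · rfl
  · unfold OracleTM.next
    have h' : O (S (Sum.inl Port.query)) = O' (S (Sum.inl Port.query)) := h
    dsimp only
    rw [h']

/-- In a bounded number of steps, a machine cannot distinguish between oracles which agree on all
queries up to some length with a limiting oracle. -/
theorem OracleTM.exists_iterate_next_eq {ι : Type*} (M : OracleTM)
    (O : ℕ → ι → List Symb → List Symb) (O' : List Symb → List Symb)
    (hO : ∀ N i w, w.length ≤ N → O N i w = O' w) (C : M.Cfg) (T : ℕ) :
    ∃ N, ∀ i, ∀ t ≤ T, (M.next (O N i))^[t] C = (M.next O')^[t] C := by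
  -- a bound for the lengths of all queries to the limiting oracle
  refine ⟨∑ t ∈ Finset.range T, (((M.next O')^[t] C).stk (Sum.inl Port.query)).length,
    fun i t ht => ?_⟩
  induction t with
  | zero => rfl
  | succ t ih =>
    rw [Function.iterate_succ_apply', Function.iterate_succ_apply', ih (by omega)]
    refine M.next_congr _ (hO _ _ _ ?_)
    exact Finset.single_le_sum (f := fun t =>
      (((M.next O')^[t] C).stk (Sum.inl Port.query) : List Symb).length)
      (fun _ _ => Nat.zero_le _) (Finset.mem_range.2 (by omega))

/-- The digits of the parameters `1` and `4`. -/
def paramDigits (b : Bool) : List Symb := if b then [zero, zero, one] else [one]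

/-- The two values of the parameter. -/
noncomputable def param (b : Bool) : ℝ := if b then 4 else 1

theorem digitsVal_paramDigits (b : Bool) : ((digitsVal (paramDigits b) : ℤ) : ℝ) = param b := by
  cases b <;> simp [paramDigits, param, dig]

theorem one_le_param (b : Bool) : 1 ≤ param b ∧ param b ≤ 4 := by
  cases b <;> simp [param]

theorem computesInPolyTime_param (N : ℕ) (b : Bool) :
    ComputesInPolyTime (machine (evalProg N (paramDigits b))) annulus
      (spiralField (scale N) (param b)) := by
  rw [← digitsVal_paramDigits]
  apply computesInPolyTime_evalProg <;> cases b <;> simp [paramDigits, dig]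

theorem isInstance_param (N : ℕ) (b : Bool) :
    IsInstance 3 annulus (spiralField (scale N) (param b)) :=
  isInstance_spiralField (scale_pos N) (scale_le N) (one_le_param b).1 (one_le_param b).2

theorem onLimitCycle_param (N : ℕ) (b : Bool) :
    onLimitCycle (spiralField (scale N) (param b)) annulus = circleSq (param b) :=
  onLimitCycle_spiralField (scale_pos N) (one_le_param b).1 (one_le_param b).2

/-- If a machine gives outputs for both parameters within `T` steps, these outputs are equal,
provided that the nonlinear part of the vector field is small enough. The map `A` turns a black box
into the oracle of the machine, and allows for access to a point besides that to the field. -/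
theorem exists_forall_output_eq (M : OracleTM) (w : List Symb) (T : ℕ)
    (A : (List Symb → List Symb) → List Symb → List Symb)
    (hA : ∀ O O' : List Symb → List Symb, ∀ w, O w = O' w → A O w = A O' w) :
    ∃ N, ∀ t ≤ T, ∀ t' ≤ T, ∀ out out',
      M.OutputsWithin (A (blackBox 2 (machine (evalProg N (paramDigits false))))) w t out →
      M.OutputsWithin (A (blackBox 2 (machine (evalProg N (paramDigits true))))) w t' out' →
      out = out' := by
  obtain ⟨N, hN⟩ := M.exists_iterate_next_eq
    (fun N b => A (blackBox 2 (machine (evalProg N (paramDigits b)))))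
    -- the limiting oracle: on queries of length `N` it is the black box for the `N`-th field
    (A fun w => blackBox 2 (machine (evalProg w.length (paramDigits false))) w)
    (fun N b w hw => hA _ _ _ (blackBox_evalProg_congr _ _ hw le_rfl)) (M.start w) T
  refine ⟨N, fun t ht t' ht' out out' h h' => ?_⟩
  have e := (hN false T le_rfl).trans (hN true T le_rfl).symm
  have h1 := h.mono ht
  unfold OracleTM.OutputsWithin at h1
  rw [e] at h1
  exact OracleTM.OutputsWithin.unique (t := T) h1 h'

/-! ### Uniqueness of the encoding -/

theorem map_bitSymb_append_inj {s : Symb} (hs : ∀ b, bitSymb b ≠ s) {l l' : List Bool}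
    {r r' : List Symb} (h : l.map bitSymb ++ s :: r = l'.map bitSymb ++ s :: r') :
    l = l' ∧ r = r' := by
  have hinj : ∀ a b : Bool, bitSymb a = bitSymb b → a = b := by decide
  induction l generalizing l' with
  | nil =>
    rcases l' with _ | ⟨b, l'⟩
    · simpa using h
    · simp only [List.map_nil, List.nil_append, List.map_cons, List.cons_append,
        List.cons.injEq] at h
      exact absurd h.1.symm (hs b)
  | cons a l ih =>
    rcases l' with _ | ⟨b, l'⟩
    · simp only [List.map_nil, List.nil_append, List.map_cons, List.cons_append,
        List.cons.injEq] at h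
      exact absurd h.1 (hs a)
    · simp only [List.map_cons, List.cons_append, List.cons.injEq] at h
      obtain ⟨h1, h2⟩ := ih h.2
      exact ⟨by rw [hinj _ _ h.1, h1], h2⟩

theorem encode_append_inj {a b : DyadicString} {r r' : List Symb}
    (h : a.encode ++ sep :: r = b.encode ++ sep :: r') : a = b ∧ r = r' := by
  simp only [DyadicString.encode, List.cons_append, List.append_assoc, List.cons.injEq] at h
  obtain ⟨h1, h2⟩ := map_bitSymb_append_inj (by decide) h.2
  obtain ⟨h3, h4⟩ := map_bitSymb_append_inj (by decide) h2
  have h5 : a.neg = b.neg := by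
    have := h.1
    cases ha : a.neg <;> cases hb : b.neg <;> simp_all
  refine ⟨?_, h4⟩
  cases a
  cases b
  simp_all

theorem encodeTuple_injective : Function.Injective (encodeTuple (d := 2)) := by
  intro q q' h
  simp only [encodeTuple, List.ofFn_succ, List.flatten_cons, List.append_assoc,
    List.singleton_append] at h
  obtain ⟨h0, h1⟩ := encode_append_inj h
  obtain ⟨h2, -⟩ := encode_append_inj h1
  funext i
  fin_cases i
  · exact h0
  · exact h2

/-! ### The lower bounds -/

theorem not_approximates_both {q : Fin 2 → DyadicString} {y z : Plane} (hy : y ∈ circleSq 1)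
    (hz : z ∈ circleSq 4) (hqy : Approximates q 2 y) (hqz : Approximates q 2 z) : False := by
  have hy' : y 0 ^ 2 + y 1 ^ 2 = 1 := hy
  have hz' : z 0 ^ 2 + z 1 ^ 2 = 4 := hz
  have h : ∀ i, (z i - y i) ^ 2 ≤ 1 / 4 := by
    intro i
    have h1 := abs_le.1 (hqy i)
    have h2 := abs_le.1 (hqz i)
    norm_num at h1 h2
    nlinarith
  have h0 := h 0
  have h1 := h 1
  nlinarith [sq_nonneg (z 0 - y 0 - y 0), sq_nonneg (z 1 - y 1 - y 1)]

/-- A representation of the point `(1, 0)`. -/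
def pointName (m : ℕ) : Fin 2 → DyadicString := ![mkDyadic false (2 ^ m) m, mkDyadic false 0 m]

theorem represents_pointName : Represents pointName !₂[1, 0] := by
  intro m
  constructor
  · intro i
    fin_cases i <;> exact prec_mkDyadic _ _ _
  · intro i
    fin_cases i
    · simp [pointName, value_mkDyadic]
    · simp [pointName, value_mkDyadic]

/-- A decision problem is hard if the point `(1, 0)` is a positive instance for the fields with
parameter `1`, and a negative one for those with parameter `4`. -/
theorem decision_of_separation (L : NNReal)
    (Yes : (Plane → Plane) → Set Plane)
    (hP : ∀ N b, IsInstance L annulus (spiralField (scale N) (param b)))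
    (h1 : ∀ N, !₂[1, 0] ∈ Yes (spiralField (scale N) (param false)))
    (h4 : ∀ N, !₂[1, 0] ∉ Yes (spiralField (scale N) (param true))) :
    DecisionArbitrarilyHighComplexity annulus (IsInstance L annulus) Yes := by
  intro K M
  have hx : (!₂[1, 0] : Plane) ∈ annulus := by
    rw [mem_annulus_iff]
    simp
  obtain ⟨N, hN⟩ := exists_forall_output_eq M [] K
    (fun O w => if w = unary w.length then nameOracle pointName w else O w)
    (fun O O' w h => by simp only [h])
  by_contra! hcon
  obtain ⟨t, ht, ho⟩ := hcon _ _ (computesInPolyTime_param N false) (hP N false) _ hx _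
    represents_pointName
  obtain ⟨t', ht', ho'⟩ := hcon _ _ (computesInPolyTime_param N true) (hP N true) _ hx _
    represents_pointName
  have := hN t ht.le t' ht'.le _ _ ho ho'
  rw [if_pos (h1 N), if_neg (h4 N)] at this
  exact absurd this (by decide)

/-- Precision `2 ^ (-2)` suffices for the lower bound, since the two limit cycles are at distance
`1` from each other. -/
theorem searchArbitrarilyHighComplexity :
    SearchArbitrarilyHighComplexity annulus (IsInstance 3 annulus)
      (fun f => onLimitCycle f annulus) := by
  intro K M
  obtain ⟨N, hN⟩ := exists_forall_output_eq M (unary 2) (K 2) (fun O => O) (fun O O' w h => h)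
  by_contra! hcon
  obtain ⟨t, ht, q, ho, y, hy, hqy⟩ := hcon _ _ (computesInPolyTime_param N false)
    (isInstance_param N false) 2 (by norm_num)
  obtain ⟨t', ht', q', ho', z, hz, hqz⟩ := hcon _ _ (computesInPolyTime_param N true)
    (isInstance_param N true) 2 (by norm_num)
  obtain rfl := encodeTuple_injective (hN t ht.le t' ht'.le _ _ ho ho')
  rw [onLimitCycle_param] at hy hz
  exact not_approximates_both (by simpa [param] using hy) (by simpa [param] using hz) hqy hqz

theorem theorem5 :
    ∃ L : NNReal,
      SearchArbitrarilyHighComplexity annulus (IsInstance L annulus)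
        (fun f => onLimitCycle f annulus) ∧
      DecisionArbitrarilyHighComplexity annulus (IsInstance L annulus)
        (fun f => onLimitCycle f annulus) ∧
      ∀ ε : ℝ, 0 < ε → ε ≤ 1 / 4 →
        DecisionArbitrarilyHighComplexity annulus (IsInstance L annulus)
          (fun f => nearLimitCycle ε f annulus) := by
  have h1 : ∀ N, (!₂[1, 0] : Plane) ∈
      onLimitCycle (spiralField (scale N) (param false)) annulus := by
    intro N
    rw [onLimitCycle_param]
    simp [circleSq, param]
  refine ⟨3, searchArbitrarilyHighComplexity, ?_, fun ε hε hε' => ?_⟩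
  · refine decision_of_separation 3 _ isInstance_param h1 fun N h => ?_
    rw [onLimitCycle_param] at h
    simp [circleSq, param] at h
  · refine decision_of_separation 3 _ isInstance_param
      (fun N => ⟨_, h1 N, by rw [dist_self]; exact hε.le⟩) ?_
    rintro N ⟨y, hy, hd⟩
    rw [onLimitCycle_param] at hy
    have hy' : y 0 ^ 2 + y 1 ^ 2 = 4 := by simpa [circleSq, param] using hy
    rw [EuclideanSpace.dist_eq, Real.sqrt_le_left hε.le, Fin.sum_univ_two] at hd
    simp only [Real.dist_eq, sq_abs, Matrix.cons_val_zero, Matrix.cons_val_one,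
      Matrix.cons_val_fin_one] at hd
    nlinarith [sq_nonneg (y 1), sq_nonneg (y 0 - 2)]
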